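/- All surfaces and functions are smooth ($C^\infty$). Let $\mathbb R^3_1$ be $\mathbb R^3$ with the scalar product $\langle a,b\rangle=-a_1b_1+a_2b_2+a_3b_3$. A proper motion is a map $y\mapsto Ay+b$ where $A$ preserves $\langle\cdot,\cdot\rangle$ and $\det A=1$. Let $x:D\to\mathbb R^3_1$ be an immersion of an open set $D\subset\mathbb R^2$. Its first fundamental form has coefficients $E=\langle x_u,x_u\rangle$, $F=\langle x_u,x_v\rangle$, $G=\langle x_v,x_v\rangle$, and $(D,x)$ is a Lorentz surface if $EG-F^2<0$ on $D$. With the vector product given by $\langle a\times b,c\rangle=\det(a,b,c)$ and the unit normal $l=\frac{x_u\times x_v}{|x_u\times x_v|}$, where $|w|=\sqrt{|\langle w,w\rangle|}$, put $L=\langle x_{uu},l\rangle$, $M=\langle x_{uv},l\rangle$, $N=\langle x_{vv},l\rangle$, and $$K=\frac{LN-M^2}{EG-F^2},\qquad H=\frac{EN-2FM+GL}{2(EG-F^2)}.$$ The surface is of general type if $H^2-K\neq0$ on $D$. For such a surface and $(u_0,v_0)\in D$, the coordinates $(u,v)$ are canonical isotropic coordinates with initial point $x_0=x(u_0,v_0)$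 if $E=G=0$ and $F>0$ on $D$ and, for some constants $\varepsilon_1,\varepsilon_2\in\{1,-1\}$, $L(u,v_0)=\varepsilon_1$ whenever $(u,v_0)\in D$, and $N(u_0,v)=\varepsilon_2$ whenever $(u_0,v)\in D$. The natural equation with signs $\varepsilon_1,\varepsilon_2$ and base point $(u_0,v_0)$ is $$\frac{FF_{uv}-F_uF_v}{F}=\Big(\varepsilon_1+\int_{v_0}^{v}F(u,s)H_u(u,s)\,ds\Big)\Big(\varepsilon_2+\int_{u_0}^{u}F(s,v)H_v(s,v)\,ds\Big)-F^2H^2 .$$ Functions $F,H$ on an open set $D$ are said to satisfy it if it holds at every $(u,v)\in D$ for which the segments joining $(u,v_0)$ and $(u_0,v)$ to $(u,v)$ lie in $D$ (every point, if $D$ is a rectangle containing $(u_0,v_0)$ with sides parallel to the axes). **Theorem.** (1) Let $(D,x)$ be a Lorentz surface of general type in $\mathbb R^3_1$ in canonical isotropic coordinates with initial point $x_0=x(u_0,v_0)$ and with signs $\varepsilon_1,\varepsilon_2$ as above. Then the coefficient $F>0$ and the mean curvature $H$ are smooth and satisfy the natural equation with signs $\varepsilon_1,\varepsilon_2$ on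 $D$. If $g$ is a proper motion, then $(D,g\circ x)$ is again a Lorentz surface of general type in canonical isotropic coordinates, with initial point $g(x_0)$ and the same signs $\varepsilon_1,\varepsilon_2$, and it has the same $F$ and $H$ on $D$, so it generates the same solution of the natural equation. (2) Conversely, let $\varepsilon_1,\varepsilon_2\in\{1,-1\}$ and let $F>0$ and $H$ be smooth functions on an open neighbourhood $U$ of $(u_0,v_0)$ that satisfy the natural equation with these signs. Then, on some open rectangle $R\subset U$ containing $(u_0,v_0)$, with sides parallel to the axes, there is a Lorentz surface of general type $(R,x)$ in canonical isotropic coordinates with initial point $x(u_0,v_0)$, whose coefficient $\langle x_u,x_v\rangle$ and mean curvature are the given functions $F$ and $H$, and whose coefficients $L$ and $N$ have the signs of $\varepsilon_1$ and $\varepsilon_2$ at every point of $R$. This surface is unique up to a proper motion: on every such rectangle $R\subset U$ containing $(u_0,v_0)$, any two surfaces with these properties are related by $\hat x=g\circ x$ for some proper motion $g$. -/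

import Mathlib

open Set
open scoped ContDiff Matrix

noncomputable section

namespace LorentzSurface

/-- The vectors of Minkowski 3-space; the indefinite scalar product is `mink`. -/
abbrev R31 : Type := Fin 3 → ℝ

/-- The scalar product `-a₁b₁ + a₂b₂ + a₃b₃`. -/
def mink (a b : R31) : ℝ := -(a 0 * b 0) + a 1 * b 1 + a 2 * b 2

/-- The vector product of Minkowski 3-space, characterised by
`⟨a × b, c⟩ = det (a, b, c)` (see `mink_lcross`). -/
def lcross (a b : R31) : R31 :=
  ![-(a 1 * b 2 - a 2 * b 1), a 2 * b 0 - a 0 * b 2, a 0 * b 1 - a 1 * b 0]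

theorem mink_lcross (a b c : R31) : mink (lcross a b) c = Matrix.det (Matrix.of ![a, b, c]) := by
  simp [mink, lcross, Matrix.det_fin_three]
  ring

/-- A proper motion of Minkowski 3-space: an affine map whose linear part preserves the scalar
product and has determinant `1`. -/
def IsProperMotion (g : R31 → R31) : Prop :=
  ∃ (A : Matrix (Fin 3) (Fin 3) ℝ) (b : R31),
    (∀ y z : R31, mink (A *ᵥ y) (A *ᵥ z) = mink y z) ∧ A.det = 1 ∧ ∀ y, g y = A *ᵥ y + b

/-- The partial derivative with respect to the first coordinate `u`. -/
def du {V : Type*} [NormedAddCommGroup V] [NormedSpace ℝ V] (f : ℝ × ℝ → V) (p : ℝ × ℝ) : V :=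
  fderiv ℝ f p (1, 0)

/-- The partial derivative with respect to the second coordinate `v`. -/
def dv {V : Type*} [NormedAddCommGroup V] [NormedSpace ℝ V] (f : ℝ × ℝ → V) (p : ℝ × ℝ) : V :=
  fderiv ℝ f p (0, 1)

/-! The coefficients of the first fundamental form of a parametrized surface. -/

def coeffE (x : ℝ × ℝ → R31) (p : ℝ × ℝ) : ℝ := mink (du x p) (du x p)

def coeffF (x : ℝ × ℝ → R31) (p : ℝ × ℝ) : ℝ := mink (du x p) (dv x p)

def coeffG (x : ℝ × ℝ → R31) (p : ℝ × ℝ) : ℝ := mink (dv x p) (dv x p)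

/-- The unit normal `(x_u × x_v) / |x_u × x_v|`. -/
def normal (x : ℝ × ℝ → R31) (p : ℝ × ℝ) : R31 :=
  (Real.sqrt |mink (lcross (du x p) (dv x p)) (lcross (du x p) (dv x p))|)⁻¹ •
    lcross (du x p) (dv x p)

/-! The coefficients of the second fundamental form. -/

def coeffL (x : ℝ × ℝ → R31) (p : ℝ × ℝ) : ℝ := mink (du (du x) p) (normal x p)

def coeffM (x : ℝ × ℝ → R31) (p : ℝ × ℝ) : ℝ := mink (dv (du x) p) (normal x p)

def coeffN (x : ℝ × ℝ → R31) (p : ℝ × ℝ) : ℝ := mink (dv (dv x) p) (normal x p)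

/-- The Gauss curvature. -/
def gaussK (x : ℝ × ℝ → R31) (p : ℝ × ℝ) : ℝ :=
  (coeffL x p * coeffN x p - coeffM x p ^ 2) / (coeffE x p * coeffG x p - coeffF x p ^ 2)

/-- The mean curvature. -/
def meanH (x : ℝ × ℝ → R31) (p : ℝ × ℝ) : ℝ :=
  (coeffE x p * coeffN x p - 2 * coeffF x p * coeffM x p + coeffG x p * coeffL x p) /
    (2 * (coeffE x p * coeffG x p - coeffF x p ^ 2))

/-- `(D, x)` is a (smooth, parametrized) Lorentz surface: `x` is a smooth immersion of the open
set `D`, and the induced metric is indefinite and nondegenerate at each point. -/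
structure IsLorentzSurface (D : Set (ℝ × ℝ)) (x : ℝ × ℝ → R31) : Prop where
  isOpen : IsOpen D
  smooth : ContDiffOn ℝ ∞ x D
  immersion : ∀ p ∈ D, Function.Injective (fderiv ℝ x p)
  lorentz : ∀ p ∈ D, coeffE x p * coeffG x p - coeffF x p ^ 2 < 0

/-- A Lorentz surface of general type: `H² - K` vanishes nowhere. -/
structure IsGeneralType (D : Set (ℝ × ℝ)) (x : ℝ × ℝ → R31) : Prop
    extends IsLorentzSurface D x where
  general : ∀ p ∈ D, meanH x p ^ 2 - gaussK x p ≠ 0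

/-- `(D, x)` is a Lorentz surface of general type whose coordinates `(u, v)` are isotropic
(`E = G = 0`) with `F > 0` and canonical with initial point `x p₀`, where `p₀ = (u₀, v₀)`:
`L(u, v₀) = ε₁` and `N(u₀, v) = ε₂` with signs `ε₁`, `ε₂`. -/
structure IsCanonical (D : Set (ℝ × ℝ)) (x : ℝ × ℝ → R31) (p₀ : ℝ × ℝ) (ε₁ ε₂ : ℝ) : Prop
    extends IsGeneralType D x where
  mem : p₀ ∈ D
  isotropicE : ∀ p ∈ D, coeffE x p = 0
  isotropicG : ∀ p ∈ D, coeffG x p = 0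
  posF : ∀ p ∈ D, 0 < coeffF x p
  sign₁ : ε₁ = 1 ∨ ε₁ = -1
  sign₂ : ε₂ = 1 ∨ ε₂ = -1
  canonicalL : ∀ u : ℝ, (u, p₀.2) ∈ D → coeffL x (u, p₀.2) = ε₁
  canonicalN : ∀ v : ℝ, (p₀.1, v) ∈ D → coeffN x (p₀.1, v) = ε₂

/-- `F > 0` and `H` are smooth on `D` and satisfy the natural equation there, with base point
`p₀ = (u₀, v₀)` and signs `ε₁`, `ε₂`. The equation is required at each point `(u, v)` of `D` for
which both segments of integration lie in `D`, so that its right-hand side is meaningful; if `D`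
is a rectangle around `p₀` these are all its points. -/
structure IsNaturalSolution (D : Set (ℝ × ℝ)) (p₀ : ℝ × ℝ) (ε₁ ε₂ : ℝ) (F H : ℝ × ℝ → ℝ) :
    Prop where
  smoothF : ContDiffOn ℝ ∞ F D
  smoothH : ContDiffOn ℝ ∞ H D
  posF : ∀ p ∈ D, 0 < F p
  equation : ∀ u v : ℝ, (∀ s ∈ uIcc p₀.2 v, (u, s) ∈ D) → (∀ s ∈ uIcc p₀.1 u, (s, v) ∈ D) →
    (F (u, v) * dv (du F) (u, v) - du F (u, v) * dv F (u, v)) / F (u, v) =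
      (ε₁ + ∫ s in p₀.2..v, F (u, s) * du H (u, s)) *
        (ε₂ + ∫ s in p₀.1..u, F (s, v) * dv H (s, v)) - F (u, v) ^ 2 * H (u, v) ^ 2

/-- An open rectangle with sides parallel to the axes. -/
def IsOpenRectangle (R : Set (ℝ × ℝ)) : Prop :=
  ∃ a b c d : ℝ, R = Ioo a b ×ˢ Ioo c d

/-- `(D, x)` is a Lorentz surface of general type in canonical isotropic coordinates with initial
point `x p₀`, with coefficient `F` of the first fundamental form, with mean curvature `H`, and
with the signs of `L` and `N` equal to those of `ε₁` and `ε₂`. -/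
structure Realizes (D : Set (ℝ × ℝ)) (x : ℝ × ℝ → R31) (p₀ : ℝ × ℝ) (ε₁ ε₂ : ℝ)
    (F H : ℝ × ℝ → ℝ) : Prop where
  canonical : ∃ δ₁ δ₂ : ℝ, IsCanonical D x p₀ δ₁ δ₂
  firstF : EqOn (coeffF x) F D
  mean : EqOn (meanH x) H D
  signL : ∀ p ∈ D, SignType.sign (coeffL x p) = SignType.sign ε₁
  signN : ∀ p ∈ D, SignType.sign (coeffN x p) = SignType.sign ε₂

end LorentzSurface

end

open LorentzSurface

/-! In isotropic coordinates the frame `a = x_u`, `b = x_v`, `l` satisfies a linear first-order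
system whose coefficients involve only `F`, `F_u`, `F_v`, `L`, `N` and `M = F H`
(`IsCanonical.frameEqs`). The Codazzi equations become `L_v = F H_u` and `N_u = F H_v`. Integrated
from the lines `v = v₀` and `u = u₀`, where canonical coordinates prescribe `L = ε₁` and `N = ε₂`,
they identify `L` and `N` with the two brackets of the natural equation. The natural equation is
then the Gauss equation `(F F_uv - F_u F_v) / F = L N - F² H²`.

Conversely, given `F` and `H`, take the two brackets as `L` and `N`. Codazzi holds by construction
and Gauss by hypothesis, and together they are the compatibility conditions of the linear system. A
linear Frobenius theorem (`exists_solution_linear_system`) then yields a position and a frame with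
any prescribed initial value. That the solution really is an isotropic frame follows from two first
integrals: the pairing `(a' b + b' a) / F + l' l` of two scalar solutions (`FrameEqs.pairing_eq`)
and the determinant of the frame divided by `F` (`FrameEqs.det_eq`). Since `H² - K = L N / F²`, the
surface is of general type wherever `L` and `N` keep the signs they have at the base point.

Uniqueness rests on the same pairing. On a rectangle `F` and `H` determine `L`, `M`, `N`, so the
frames of two surfaces solve one system, and the matrix carrying one frame to the other has pairings
as entries, up to sign. It is therefore constant, and it is the linear part of the motion. -/

namespace LorentzSurface

open Filter Topology MeasureTheory

/-! ### Calculus in two variables: partial derivatives and parametric primitives. -/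

variable {V : Type*} [NormedAddCommGroup V] [NormedSpace ℝ V]

/-- The linear map `(h, k) ↦ h • a + k • b`. -/
noncomputable def gradMap (a b : V) : ℝ × ℝ →L[ℝ] V :=
  (ContinuousLinearMap.toSpanSingleton ℝ a).coprod (ContinuousLinearMap.toSpanSingleton ℝ b)

@[simp]
theorem gradMap_apply (a b : V) (h : ℝ × ℝ) : gradMap a b h = h.1 • a + h.2 • b := by
  simp [gradMap]

theorem continuous_toSpanSingleton :
    Continuous fun a : V => ContinuousLinearMap.toSpanSingleton ℝ a :=
  (ContinuousLinearMap.toSpanSingletonCLE (𝕜 := ℝ) (E := V)).continuous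

theorem contDiff_gradMap {n : WithTop ℕ∞} :
    ContDiff ℝ n fun q : V × V => gradMap q.1 q.2 := by
  have h : (fun q : V × V => gradMap q.1 q.2) = fun q : V × V =>
      ((ContinuousLinearMap.toSpanSingletonCLE (𝕜 := ℝ) (E := V)) q.1).comp
        (ContinuousLinearMap.fst ℝ ℝ ℝ) +
      ((ContinuousLinearMap.toSpanSingletonCLE (𝕜 := ℝ) (E := V)) q.2).comp
        (ContinuousLinearMap.snd ℝ ℝ ℝ) := by
    funext q
    ext <;> simp
  rw [h]
  fun_prop

theorem fderiv_eq_gradMap (f : ℝ × ℝ → V) (p : ℝ × ℝ) :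
    fderiv ℝ f p = gradMap (du f p) (dv f p) := by
  ext <;> simp [du, dv]

theorem _root_.DifferentiableAt.hasFDerivAt_gradMap {f : ℝ × ℝ → V} {p : ℝ × ℝ}
    (h : DifferentiableAt ℝ f p) : HasFDerivAt f (gradMap (du f p) (dv f p)) p :=
  fderiv_eq_gradMap f p ▸ h.hasFDerivAt

theorem du_eq_of_hasFDerivAt {f : ℝ × ℝ → V} {p : ℝ × ℝ} {a b : V}
    (h : HasFDerivAt f (gradMap a b) p) : du f p = a := by
  simp [du, h.fderiv]

theorem dv_eq_of_hasFDerivAt {f : ℝ × ℝ → V} {p : ℝ × ℝ} {a b : V}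
    (h : HasFDerivAt f (gradMap a b) p) : dv f p = b := by
  simp [dv, h.fderiv]

theorem hasDerivAt_fst_of_hasFDerivAt {f : ℝ × ℝ → V} {p : ℝ × ℝ} {a b : V}
    (h : HasFDerivAt f (gradMap a b) p) : HasDerivAt (fun s => f (s, p.2)) a p.1 := by
  have h2 : HasDerivAt (fun s : ℝ => (s, p.2)) ((1 : ℝ), (0 : ℝ)) p.1 :=
    (hasDerivAt_id p.1).prodMk (hasDerivAt_const _ _)
  simpa [Function.comp_def] using HasFDerivAt.comp_hasDerivAt (x := p.1) (l := f) h h2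

theorem hasDerivAt_snd_of_hasFDerivAt {f : ℝ × ℝ → V} {p : ℝ × ℝ} {a b : V}
    (h : HasFDerivAt f (gradMap a b) p) : HasDerivAt (fun s => f (p.1, s)) b p.2 := by
  have h2 : HasDerivAt (fun s : ℝ => (p.1, s)) ((0 : ℝ), (1 : ℝ)) p.2 :=
    (hasDerivAt_const _ _).prodMk (hasDerivAt_id p.2)
  simpa [Function.comp_def] using HasFDerivAt.comp_hasDerivAt (x := p.2) (l := f) h h2

theorem hasFDerivAt_of_partials {f f₁ f₂ : ℝ × ℝ → V} {p : ℝ × ℝ}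
    (h₁ : ∀ᶠ q in 𝓝 p, HasDerivAt (fun s => f (s, q.2)) (f₁ q) q.1)
    (h₂ : ∀ᶠ q in 𝓝 p, HasDerivAt (fun s => f (q.1, s)) (f₂ q) q.2)
    (c₁ : ContinuousAt f₁ p) (c₂ : ContinuousAt f₂ p) :
    HasFDerivAt f (gradMap (f₁ p) (f₂ p)) p := by
  have := hasStrictFDerivAt_uncurry_coprod (𝕜 := ℝ) (u := p) (f := fun s t => f (s, t))
    (f₁ := fun s t => ContinuousLinearMap.toSpanSingleton ℝ (f₁ (s, t)))
    (f₂ := fun s t => ContinuousLinearMap.toSpanSingleton ℝ (f₂ (s, t)))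
    (h₁.mono fun q hq => hq.hasFDerivAt) (h₂.mono fun q hq => hq.hasFDerivAt)
    (continuous_toSpanSingleton.continuousAt.comp c₁)
    (continuous_toSpanSingleton.continuousAt.comp c₂)
  exact this.hasFDerivAt

theorem _root_.ContDiff.du {f : ℝ × ℝ → V} (hf : ContDiff ℝ ∞ f) : ContDiff ℝ ∞ (du f) :=
  (hf.fderiv_right (m := ∞) (by simp)).clm_apply contDiff_const

theorem _root_.ContDiff.dv {f : ℝ × ℝ → V} (hf : ContDiff ℝ ∞ f) : ContDiff ℝ ∞ (dv f) :=
  (hf.fderiv_right (m := ∞) (by simp)).clm_apply contDiff_const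

theorem _root_.ContDiffOn.du {f : ℝ × ℝ → V} {D : Set (ℝ × ℝ)} (hD : IsOpen D)
    (hf : ContDiffOn ℝ ∞ f D) : ContDiffOn ℝ ∞ (du f) D :=
  (hf.fderiv_of_isOpen hD (m := ∞) (by simp)).clm_apply contDiffOn_const

theorem _root_.ContDiffOn.dv {f : ℝ × ℝ → V} {D : Set (ℝ × ℝ)} (hD : IsOpen D)
    (hf : ContDiffOn ℝ ∞ f D) : ContDiffOn ℝ ∞ (dv f) D :=
  (hf.fderiv_of_isOpen hD (m := ∞) (by simp)).clm_apply contDiffOn_const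

theorem _root_.ContDiffOn.differentiableAt_of_isOpen {f : ℝ × ℝ → V} {D : Set (ℝ × ℝ)}
    (hD : IsOpen D) (hf : ContDiffOn ℝ ∞ f D) {p : ℝ × ℝ} (hp : p ∈ D) :
    DifferentiableAt ℝ f p :=
  (hf.contDiffAt (hD.mem_nhds hp)).differentiableAt (by simp)

theorem du_congr {f g : ℝ × ℝ → V} {D : Set (ℝ × ℝ)} (hD : IsOpen D) (h : EqOn f g D) :
    EqOn (du f) (du g) D := fun p hp => by
  simp only [du, (h.eventuallyEq_of_mem (hD.mem_nhds hp)).fderiv_eq]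

theorem dv_congr {f g : ℝ × ℝ → V} {D : Set (ℝ × ℝ)} (hD : IsOpen D) (h : EqOn f g D) :
    EqOn (dv f) (dv g) D := fun p hp => by
  simp only [dv, (h.eventuallyEq_of_mem (hD.mem_nhds hp)).fderiv_eq]

theorem du_dv_comm {f : ℝ × ℝ → V} {p : ℝ × ℝ} (hf : ContDiffAt ℝ ∞ f p) :
    du (dv f) p = dv (du f) p := by
  have hsymm := hf.isSymmSndFDerivAt
    (by simpa using WithTop.coe_le_coe.2 (le_top : (2 : ℕ∞) ≤ ⊤))
  have hd : DifferentiableAt ℝ (fderiv ℝ f) p :=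
    (hf.fderiv_right (m := ∞) (by simp)).differentiableAt (by simp)
  have h1 : fderiv ℝ (fun q => fderiv ℝ f q (0, 1)) p (1, 0) =
      fderiv ℝ (fderiv ℝ f) p (1, 0) (0, 1) := by
    simp [fderiv_clm_apply hd (differentiableAt_const _)]
  have h2 : fderiv ℝ (fun q => fderiv ℝ f q (1, 0)) p (0, 1) =
      fderiv ℝ (fderiv ℝ f) p (0, 1) (1, 0) := by
    simp [fderiv_clm_apply hd (differentiableAt_const _)]
  exact h1.trans ((hsymm.eq (1, 0) (0, 1)).trans h2.symm)

/-- Differentiation under the integral sign along the second coordinate. -/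
theorem hasDerivAt_integral_snd {f f' : ℝ × ℝ → V} (hf : Continuous f) (hf' : Continuous f')
    {a b c d v : ℝ} (hv : v ∈ Ioo c d)
    (h : ∀ s ∈ uIcc a b, ∀ t ∈ Ioo c d, HasDerivAt (fun t => f (s, t)) (f' (s, t)) t) :
    HasDerivAt (fun t => ∫ s in a..b, f (s, t)) (∫ s in a..b, f' (s, v)) v := by
  obtain ⟨C, hC⟩ := ((isCompact_uIcc (a := a) (b := b)).prod
    (isCompact_Icc (a := c) (b := d))).exists_bound_of_continuousOn hf'.continuousOn
  have hcs : ∀ {g : ℝ × ℝ → V} (_ : Continuous g) (t : ℝ), Continuous fun s => g (s, t) :=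
    fun hg t => by fun_prop
  refine (intervalIntegral.hasDerivAt_integral_of_dominated_loc_of_deriv_le
    (F := fun t s => f (s, t)) (F' := fun t s => f' (s, t)) (bound := fun _ => C)
    (Ioo_mem_nhds hv.1 hv.2) (Eventually.of_forall fun t => (hcs hf t).aestronglyMeasurable)
    ((hcs hf v).intervalIntegrable _ _) (hcs hf' v).aestronglyMeasurable ?_ (by simp) ?_).2
  · exact Eventually.of_forall fun s hs t ht =>
      hC (s, t) ⟨uIoc_subset_uIcc hs, Ioo_subset_Icc_self ht⟩
  · exact Eventually.of_forall fun s hs t ht => h s (uIoc_subset_uIcc hs) t ht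

theorem hasFDerivAt_primitive_fst [CompleteSpace V] {f : ℝ × ℝ → V}
    (hf : ContDiff ℝ 1 f) (a : ℝ) (p : ℝ × ℝ) :
    HasFDerivAt (fun p : ℝ × ℝ => ∫ s in a..p.1, f (s, p.2))
      (gradMap (f p) (∫ s in a..p.1, dv f (s, p.2))) p := by
  have hdv : Continuous (dv f) :=
    (hf.continuous_fderiv (by simp)).clm_apply continuous_const
  have hfc := hf.continuous
  refine hasFDerivAt_of_partials (f₁ := f) (f₂ := fun p => ∫ s in a..p.1, dv f (s, p.2))
    (Eventually.of_forall fun q => ?_) (Eventually.of_forall fun q => ?_) hfc.continuousAt ?_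
  · have hc : Continuous fun s => f (s, q.2) := by fun_prop
    exact intervalIntegral.integral_hasDerivAt_right (hc.intervalIntegrable _ _)
      (hc.stronglyMeasurableAtFilter _ _) hc.continuousAt
  · refine hasDerivAt_integral_snd hfc hdv (c := q.2 - 1) (d := q.2 + 1) (by simp) ?_
    intro s _ t _
    exact hasDerivAt_snd_of_hasFDerivAt (p := (s, t))
      ((hf.differentiable (by simp)) (s, t)).hasFDerivAt_gradMap
  · have : Continuous fun p : ℝ × ℝ => ∫ s in a..p.1, dv f (s, p.2) :=
      intervalIntegral.continuous_parametric_intervalIntegral_of_continuous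
        (f := fun (p : ℝ × ℝ) s => dv f (s, p.2)) (by fun_prop) continuous_fst
    exact this.continuousAt

/-- The two partial derivatives are `f` itself and the primitive of `dv f`, an integral of the same
shape; hence induction on the order, for all `f` at once. -/
theorem contDiff_primitive_fst [CompleteSpace V] {f : ℝ × ℝ → V} (hf : ContDiff ℝ ∞ f) (a : ℝ) :
    ContDiff ℝ ∞ fun p : ℝ × ℝ => ∫ s in a..p.1, f (s, p.2) := by
  rw [contDiff_infty]
  intro n
  induction n generalizing f with
  | zero =>
    have hfc := hf.continuous
    exact contDiff_zero.2 (intervalIntegral.continuous_parametric_intervalIntegral_of_continuous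
      (f := fun (p : ℝ × ℝ) s => f (s, p.2)) (by fun_prop) continuous_fst)
  | succ n ih =>
    have hd := hasFDerivAt_primitive_fst (hf.of_le (by exact_mod_cast le_top)) a
    push_cast
    refine (contDiff_succ_iff_fderiv (n := n)).2 ⟨fun p => (hd p).differentiableAt, by simp, ?_⟩
    have : fderiv ℝ (fun p : ℝ × ℝ => ∫ s in a..p.1, f (s, p.2)) =
        fun p => gradMap (f p) (∫ s in a..p.1, dv f (s, p.2)) := funext fun p => (hd p).fderiv
    rw [this]
    exact contDiff_gradMap.comp ((hf.of_le (by exact_mod_cast le_top)).prodMk (ih hf.dv))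

theorem hasFDerivAt_primitive_snd [CompleteSpace V] {f : ℝ × ℝ → V}
    (hf : ContDiff ℝ 1 f) (a : ℝ) (p : ℝ × ℝ) :
    HasFDerivAt (fun p : ℝ × ℝ => ∫ s in a..p.2, f (p.1, s))
      (gradMap (∫ s in a..p.2, du f (p.1, s)) (f p)) p := by
  have h := hasFDerivAt_primitive_fst (f := f ∘ Prod.swap)
    (hf.comp (ContinuousLinearEquiv.prodComm ℝ ℝ ℝ).contDiff) a p.swap
  have hsw : ∀ q : ℝ × ℝ, HasFDerivAt (Prod.swap : ℝ × ℝ → ℝ × ℝ)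
    (ContinuousLinearEquiv.prodComm ℝ ℝ ℝ : ℝ × ℝ →L[ℝ] ℝ × ℝ) q :=
    fun q => (ContinuousLinearEquiv.prodComm ℝ ℝ ℝ).hasFDerivAt
  have h2 := h.comp p (hsw p)
  have hdv : ∀ q, dv (f ∘ Prod.swap) q = du f q.swap := fun q => by
    have := (((hf.differentiable (by simp)) q.swap).hasFDerivAt.comp q (hsw q)).fderiv
    simp [dv, du, this]
  have h3 : gradMap (∫ s in a..p.2, du f (p.1, s)) (f p) =
      (gradMap ((f ∘ Prod.swap) p.swap) (∫ s in a..p.swap.1, dv (f ∘ Prod.swap) (s, p.swap.2))).comp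
        (ContinuousLinearEquiv.prodComm ℝ ℝ ℝ : ℝ × ℝ →L[ℝ] ℝ × ℝ) := by
    ext <;> simp [hdv]
  rw [h3]
  exact h2

theorem contDiff_primitive_snd [CompleteSpace V] {f : ℝ × ℝ → V} (hf : ContDiff ℝ ∞ f) (a : ℝ) :
    ContDiff ℝ ∞ fun p : ℝ × ℝ => ∫ s in a..p.2, f (p.1, s) :=
  (contDiff_primitive_fst (f := f ∘ Prod.swap)
    (hf.comp (ContinuousLinearEquiv.prodComm ℝ ℝ ℝ).contDiff) a).comp
    (ContinuousLinearEquiv.prodComm ℝ ℝ ℝ).contDiff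

end LorentzSurface

/-! ### The integral equation of a linear system along corner paths. -/

namespace LorentzSurface

open Filter Topology MeasureTheory

variable {E : Type*} [NormedAddCommGroup E] [NormedSpace ℝ E]

/-- The retraction of the real line onto `[a - r, a + r]`. -/
noncomputable def clamp (a r t : ℝ) : ℝ := max (a - r) (min (a + r) t)

theorem continuous_clamp (a r : ℝ) : Continuous (clamp a r) := by
  unfold clamp
  fun_prop

theorem clamp_mem {a r : ℝ} (hr : 0 ≤ r) (t : ℝ) : clamp a r t ∈ Icc (a - r) (a + r) :=
  ⟨le_max_left _ _, max_le (by linarith) (min_le_left _ _)⟩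

theorem clamp_of_mem {a r t : ℝ} (ht : t ∈ Icc (a - r) (a + r)) : clamp a r t = t := by
  rw [clamp, min_eq_right ht.2, max_eq_right ht.1]

theorem abs_sub_le_of_mem_Icc {a r t : ℝ} (ht : t ∈ Icc (a - r) (a + r)) : |t - a| ≤ r :=
  abs_le.2 ⟨by linarith [ht.1], by linarith [ht.2]⟩

theorem uIcc_subset_of_mem_Icc {a r t : ℝ} (ht : t ∈ Icc (a - r) (a + r)) :
    uIcc a t ⊆ Icc (a - r) (a + r) := by
  have := ht.1.trans ht.2
  exact uIcc_subset_Icc ⟨by linarith, by linarith⟩ ht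

/-- Integration of a linear system first along the line `v = v₀` and then vertically, inside the
square of radius `r`. -/
noncomputable def cornerIntegral (A B : ℝ × ℝ → E →L[ℝ] E) (p₀ : ℝ × ℝ) (r : ℝ) (W : ℝ × ℝ → E)
    (p : ℝ × ℝ) : E :=
  (∫ s in p₀.1..clamp p₀.1 r p.1, A (s, p₀.2) (W (s, p₀.2))) +
    ∫ t in p₀.2..clamp p₀.2 r p.2, B (clamp p₀.1 r p.1, t) (W (clamp p₀.1 r p.1, t))

theorem continuous_cornerIntegral {A B : ℝ × ℝ → E →L[ℝ] E} (hA : Continuous A)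
    (hB : Continuous B) (p₀ : ℝ × ℝ) (r : ℝ) {W : ℝ × ℝ → E} (hW : Continuous W) :
    Continuous (cornerIntegral A B p₀ r W) := by
  have h1 := continuous_clamp p₀.1 r
  have h2 := continuous_clamp p₀.2 r
  refine Continuous.add ?_ ?_
  · exact intervalIntegral.continuous_parametric_intervalIntegral_of_continuous
      (f := fun (_ : ℝ × ℝ) s => A (s, p₀.2) (W (s, p₀.2))) (by fun_prop) (by fun_prop)
  · exact intervalIntegral.continuous_parametric_intervalIntegral_of_continuous
      (f := fun (p : ℝ × ℝ) t => B (clamp p₀.1 r p.1, t) (W (clamp p₀.1 r p.1, t)))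
      (by fun_prop) (by fun_prop)

theorem norm_integral_clm_le {A : ℝ → E →L[ℝ] E} {W : ℝ → E} {a r b C K : ℝ}
    (hb : b ∈ Icc (a - r) (a + r)) (hC : 0 ≤ C) (hK : 0 ≤ K)
    (hA : ∀ t ∈ Icc (a - r) (a + r), ‖A t‖ ≤ C)
    (hW : ∀ t ∈ Icc (a - r) (a + r), ‖W t‖ ≤ K) :
    ‖∫ t in a..b, A t (W t)‖ ≤ C * K * r := by
  refine (intervalIntegral.norm_integral_le_of_norm_le_const (C := C * K) fun t ht => ?_).trans
    (mul_le_mul_of_nonneg_left (abs_sub_le_of_mem_Icc hb) (by positivity))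
  have ht' := uIcc_subset_of_mem_Icc hb (uIoc_subset_uIcc ht)
  exact (A t).le_of_opNorm_le_of_le (hA t ht') (hW t ht')

/-- The closed square of centre `p₀` and radius `r`. -/
def square (p₀ : ℝ × ℝ) (r : ℝ) : Set (ℝ × ℝ) :=
  Icc (p₀.1 - r) (p₀.1 + r) ×ˢ Icc (p₀.2 - r) (p₀.2 + r)

theorem norm_cornerIntegral_le {A B : ℝ × ℝ → E →L[ℝ] E} {p₀ : ℝ × ℝ} {r C K : ℝ} (hr : 0 ≤ r)
    (hC : 0 ≤ C) (hK : 0 ≤ K) (hA : ∀ p ∈ square p₀ r, ‖A p‖ ≤ C)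
    (hB : ∀ p ∈ square p₀ r, ‖B p‖ ≤ C) {W : ℝ × ℝ → E} (hW : ∀ p, ‖W p‖ ≤ K) (p : ℝ × ℝ) :
    ‖cornerIntegral A B p₀ r W p‖ ≤ 2 * C * r * K := by
  refine (norm_add_le _ _).trans ?_
  have h1 := norm_integral_clm_le (A := fun s => A (s, p₀.2)) (W := fun s => W (s, p₀.2))
    (clamp_mem hr p.1) hC hK (fun t ht => hA _ ⟨ht, by simpa using hr⟩) fun t _ => hW _
  have h2 := norm_integral_clm_le (A := fun s => B (clamp p₀.1 r p.1, s))
    (W := fun s => W (clamp p₀.1 r p.1, s))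
    (clamp_mem hr p.2) hC hK (fun t ht => hB _ ⟨clamp_mem hr _, ht⟩) fun t _ => hW _
  linarith

theorem cornerIntegral_sub {A B : ℝ × ℝ → E →L[ℝ] E} (hA : Continuous A)
    (hB : Continuous B) (p₀ : ℝ × ℝ) (r : ℝ) {W W' : ℝ × ℝ → E} (hW : Continuous W)
    (hW' : Continuous W') (p : ℝ × ℝ) :
    cornerIntegral A B p₀ r W p - cornerIntegral A B p₀ r W' p =
      cornerIntegral A B p₀ r (fun p => W p - W' p) p := by
  simp only [cornerIntegral, map_sub]
  rw [intervalIntegral.integral_sub, intervalIntegral.integral_sub]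
  · abel
  all_goals
    apply Continuous.intervalIntegrable
    fun_prop

/-- Banach's fixed point theorem: each of the two legs has length at most `r`, so the operator has
Lipschitz constant `2 * C * r ≤ 1 / 2`. By linearity this condition does not involve `w₀`. -/
theorem exists_eq_add_cornerIntegral [CompleteSpace E] {A B : ℝ × ℝ → E →L[ℝ] E}
    (hA : Continuous A) (hB : Continuous B) {p₀ : ℝ × ℝ} {r C : ℝ} (hr : 0 ≤ r) (hC : 0 ≤ C)
    (hAC : ∀ p ∈ square p₀ r, ‖A p‖ ≤ C) (hBC : ∀ p ∈ square p₀ r, ‖B p‖ ≤ C)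
    (hCr : 2 * C * r ≤ 1 / 2) (w₀ : E) :
    ∃ W : ℝ × ℝ → E, Continuous W ∧ ∀ p, W p = w₀ + cornerIntegral A B p₀ r W p := by
  -- Clamping makes the integral bounded on the whole plane, so `T` acts on the complete space of
  -- bounded continuous functions.
  let T : BoundedContinuousFunction (ℝ × ℝ) E → BoundedContinuousFunction (ℝ × ℝ) E := fun W =>
    BoundedContinuousFunction.ofNormedAddCommGroup (fun p => w₀ + cornerIntegral A B p₀ r W p)
      (continuous_const.add (continuous_cornerIntegral hA hB p₀ r W.continuous))
      (‖w₀‖ + 2 * C * r * ‖W‖) fun p => (norm_add_le _ _).trans (add_le_add le_rfl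
        (norm_cornerIntegral_le hr hC (norm_nonneg _) hAC hBC W.norm_coe_le_norm p))
  have hT : ContractingWith (1 / 2) T := by
    refine ⟨by rw [← NNReal.coe_lt_coe]; norm_num, LipschitzWith.of_dist_le_mul fun W W' => ?_⟩
    refine (BoundedContinuousFunction.dist_le (by positivity)).2 fun p => ?_
    have h1 : T W p - T W' p = cornerIntegral A B p₀ r (fun p => W p - W' p) p := by
      rw [← cornerIntegral_sub hA hB p₀ r W.continuous W'.continuous]
      simp [T]
    rw [dist_eq_norm, h1]
    refine (norm_cornerIntegral_le hr hC dist_nonneg hAC hBC (fun q => ?_) p).trans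
      (mul_le_mul_of_nonneg_right (by simpa using hCr) dist_nonneg)
    rw [← dist_eq_norm]
    exact BoundedContinuousFunction.dist_coe_le_dist q
  let W : BoundedContinuousFunction (ℝ × ℝ) E := hT.fixedPoint T
  exact ⟨W, W.continuous, fun p => (DFunLike.congr_fun hT.fixedPoint_isFixedPt p).symm⟩

theorem square_mem_nhds (p₀ : ℝ × ℝ) {r : ℝ} (hr : 0 < r) : square p₀ r ∈ 𝓝 p₀ :=
  prod_mem_nhds (Icc_mem_nhds (by linarith) (by linarith))
    (Icc_mem_nhds (by linarith) (by linarith))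

theorem square_mono (p₀ : ℝ × ℝ) {r ρ : ℝ} (h : r ≤ ρ) : square p₀ r ⊆ square p₀ ρ :=
  prod_mono (Icc_subset_Icc (by linarith) (by linarith))
    (Icc_subset_Icc (by linarith) (by linarith))

theorem isCompact_square (p₀ : ℝ × ℝ) (r : ℝ) : IsCompact (square p₀ r) :=
  isCompact_Icc.prod isCompact_Icc

theorem exists_square_subset {p₀ : ℝ × ℝ} {U : Set (ℝ × ℝ)} (hU : U ∈ 𝓝 p₀) :
    ∃ r > 0, square p₀ r ⊆ U := by
  obtain ⟨r, hr, h⟩ := Metric.nhds_basis_closedBall.mem_iff.1 hU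
  refine ⟨r, hr, fun p hp => h ?_⟩
  rw [← Prod.mk.eta (p := p₀), ← closedBall_prod_same, Real.closedBall_eq_Icc,
    Real.closedBall_eq_Icc]
  exact hp

end LorentzSurface

/-! ### Frobenius' theorem for linear systems. -/

namespace LorentzSurface

open Filter Topology MeasureTheory

variable {E : Type*} [NormedAddCommGroup E] [NormedSpace ℝ E]

/-- A continuous function on a square that vanishes on the central horizontal line and whose
vertical derivative is bounded by a small multiple of its supremum is zero. -/
theorem eq_zero_on_square {D D' : ℝ × ℝ → E} {p₀ : ℝ × ℝ} {r c : ℝ} (hr : 0 < r)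
    (hD : Continuous D) (h0 : ∀ u ∈ Icc (p₀.1 - r) (p₀.1 + r), D (u, p₀.2) = 0)
    (hd : ∀ p ∈ square p₀ r, HasDerivAt (fun t => D (p.1, t)) (D' p) p.2)
    (hb : ∀ S, (∀ p ∈ square p₀ r, ‖D p‖ ≤ S) → ∀ p ∈ square p₀ r, ‖D' p‖ ≤ c * S)
    (hcr : c * r ≤ 1 / 2) : ∀ p ∈ square p₀ r, D p = 0 := by
  -- At a maximum point `m` of the norm, the mean value inequality on the vertical segment through
  -- `m` gives `‖D m‖ ≤ c * ‖D m‖ * r ≤ ‖D m‖ / 2`.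
  obtain ⟨m, hm, hmax⟩ := (isCompact_square p₀ r).exists_isMaxOn
    ⟨p₀, mem_of_mem_nhds (square_mem_nhds p₀ hr)⟩ hD.norm.continuousOn
  have hS : ∀ p ∈ square p₀ r, ‖D p‖ ≤ ‖D m‖ := fun p hp => hmax hp
  have hb' := hb _ hS
  have hc : 0 ≤ c * ‖D m‖ := (norm_nonneg _).trans (hb' m hm)
  have h1 := (convex_Icc (p₀.2 - r) (p₀.2 + r)).norm_image_sub_le_of_norm_hasDerivWithin_le
    (f := fun t => D (m.1, t)) (f' := fun t => D' (m.1, t)) (C := c * ‖D m‖)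
    (fun t ht => (hd (m.1, t) ⟨hm.1, ht⟩).hasDerivWithinAt) (fun t ht => hb' (m.1, t) ⟨hm.1, ht⟩)
    (x := p₀.2) (by constructor <;> linarith) hm.2
  have h2 : ‖D m‖ ≤ c * ‖D m‖ * r := by
    refine le_trans ?_ (h1.trans (mul_le_mul_of_nonneg_left (abs_sub_le_of_mem_Icc hm.2) hc))
    simp [h0 m.1 hm.1]
  have h3 : ‖D m‖ ≤ 0 := by nlinarith [norm_nonneg (D m)]
  exact fun p hp => norm_le_zero_iff.1 ((hS p hp).trans h3)

theorem hasDerivAt_clm_snd {A : ℝ × ℝ → E →L[ℝ] E} (hA : ContDiff ℝ 1 A) {W : ℝ → E} {w : E}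
    {s t : ℝ} (hW : HasDerivAt W w t) :
    HasDerivAt (fun t => A (s, t) (W t)) (dv A (s, t) (W t) + A (s, t) w) t :=
  (hasDerivAt_snd_of_hasFDerivAt (p := (s, t))
    ((hA.differentiable (by simp)) (s, t)).hasFDerivAt_gradMap).clm_apply hW

theorem hasDerivAt_clm_fst {A : ℝ × ℝ → E →L[ℝ] E} (hA : ContDiff ℝ 1 A) {W : ℝ → E} {w : E}
    {s t : ℝ} (hW : HasDerivAt W w s) :
    HasDerivAt (fun s => A (s, t) (W s)) (du A (s, t) (W s) + A (s, t) w) s :=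
  (hasDerivAt_fst_of_hasFDerivAt (p := (s, t))
    ((hA.differentiable (by simp)) (s, t)).hasFDerivAt_gradMap).clm_apply hW

/-- Frobenius' theorem for linear systems in two variables: if `A_v + A B = B_u + B A` near `p₀`,
the system `w_u = A w`, `w_v = B w` is solvable on a square independent of the initial value. -/
theorem exists_solution_linear_system [CompleteSpace E] {A B : ℝ × ℝ → E →L[ℝ] E}
    (hA : ContDiff ℝ 1 A)
    (hB : ContDiff ℝ 1 B) {p₀ : ℝ × ℝ} {U : Set (ℝ × ℝ)} (hU : U ∈ 𝓝 p₀)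
    (hcompat : ∀ p ∈ U, dv A p + (A p).comp (B p) = du B p + (B p).comp (A p)) :
    ∃ r > 0, square p₀ r ⊆ U ∧ ∀ w₀ : E, ∃ w : ℝ × ℝ → E, w p₀ = w₀ ∧
      ∀ p ∈ interior (square p₀ r), HasFDerivAt w (gradMap (A p (w p)) (B p (w p))) p := by
  obtain ⟨ρ₀, hρ₀, hρU⟩ := exists_square_subset hU
  have hBu : Continuous (du B) := (hB.continuous_fderiv (by simp)).clm_apply continuous_const
  have hAv : Continuous (dv A) := (hA.continuous_fderiv (by simp)).clm_apply continuous_const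
  have hAc := hA.continuous
  have hBc := hB.continuous
  obtain ⟨C₁, hC₁⟩ := (isCompact_square p₀ 1).exists_bound_of_continuousOn hAc.continuousOn
  obtain ⟨C₂, hC₂⟩ := (isCompact_square p₀ 1).exists_bound_of_continuousOn hBc.continuousOn
  obtain ⟨C₃, hC₃⟩ := (isCompact_square p₀ 1).exists_bound_of_continuousOn hBu.continuousOn
  -- The entry `1` keeps `C` positive. Below, `ρ ≤ 1` keeps the bounds valid and `ρ ≤ 1 / (4 * C)`
  -- makes the integral operator a contraction.
  set C := max (max C₁ C₂) (max C₃ 1) with hCdef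
  have hC1 : 1 ≤ C := (le_max_right _ _).trans (le_max_right _ _)
  set ρ := min (min ρ₀ 1) (1 / (4 * C)) with hρdef
  have hρ : 0 < ρ := by positivity
  have hρ1 : ρ ≤ 1 := (min_le_left _ _).trans (min_le_right _ _)
  have hρsub : square p₀ ρ ⊆ U :=
    (square_mono p₀ ((min_le_left _ _).trans (min_le_left _ _))).trans hρU
  have hCρ : 2 * C * ρ ≤ 1 / 2 := by
    have : ρ ≤ 1 / (4 * C) := min_le_right _ _
    rw [le_div_iff₀ (by positivity)] at this
    linarith
  have hAC : ∀ p ∈ square p₀ ρ, ‖A p‖ ≤ C := fun p hp =>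
    (hC₁ p (square_mono p₀ hρ1 hp)).trans ((le_max_left _ _).trans (le_max_left _ _))
  have hBC : ∀ p ∈ square p₀ ρ, ‖B p‖ ≤ C := fun p hp =>
    (hC₂ p (square_mono p₀ hρ1 hp)).trans ((le_max_right _ _).trans (le_max_left _ _))
  have hBuC : ∀ p ∈ square p₀ ρ, ‖du B p‖ ≤ C := fun p hp =>
    (hC₃ p (square_mono p₀ hρ1 hp)).trans ((le_max_left _ _).trans (le_max_right _ _))
  -- Halving the radius puts the closed square inside the open strip where vertical derivatives are
  -- available.
  refine ⟨ρ / 2, by positivity, (square_mono p₀ (by linarith)).trans hρsub, fun w₀ => ?_⟩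
  obtain ⟨W, hWc, hW⟩ := exists_eq_add_cornerIntegral hAc hBc hρ.le (by linarith) hAC hBC hCρ w₀
  have hWeq : ∀ u ∈ Icc (p₀.1 - ρ) (p₀.1 + ρ), ∀ v ∈ Icc (p₀.2 - ρ) (p₀.2 + ρ),
      W (u, v) = w₀ + ((∫ s in p₀.1..u, A (s, p₀.2) (W (s, p₀.2))) +
        ∫ t in p₀.2..v, B (u, t) (W (u, t))) := fun u hu v hv => by
    rw [hW, cornerIntegral]
    simp only [clamp_of_mem hu, clamp_of_mem hv]
  have hWv : ∀ u ∈ Icc (p₀.1 - ρ) (p₀.1 + ρ), ∀ v ∈ Ioo (p₀.2 - ρ) (p₀.2 + ρ),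
      HasDerivAt (fun t => W (u, t)) (B (u, v) (W (u, v))) v := fun u hu v hv => by
    have hc : Continuous fun t => B (u, t) (W (u, t)) := by fun_prop
    refine (((intervalIntegral.integral_hasDerivAt_right (hc.intervalIntegrable p₀.2 v)
      (hc.stronglyMeasurableAtFilter _ _) hc.continuousAt).const_add
      (∫ s in p₀.1..u, A (s, p₀.2) (W (s, p₀.2)))).const_add w₀).congr_of_eventuallyEq ?_
    filter_upwards [Ioo_mem_nhds hv.1 hv.2] with t ht
    exact hWeq u hu t (Ioo_subset_Icc_self ht)
  have hp₁ : p₀.1 ∈ Icc (p₀.1 - ρ) (p₀.1 + ρ) := by constructor <;> linarith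
  have hp₂ : p₀.2 ∈ Icc (p₀.2 - ρ) (p₀.2 + ρ) := by constructor <;> linarith
  -- `W` satisfies the `v`-equation, but the `u`-equation is known only on the line `v = v₀`. The
  -- function `h` satisfies `h_u = A W` everywhere, so it remains to show `W = h`.
  set h : ℝ × ℝ → E := fun p => W (p₀.1, p.2) + ∫ s in p₀.1..p.1, A (s, p.2) (W (s, p.2)) with hh
  have hhc : Continuous h := by
    refine Continuous.add (by fun_prop) ?_
    exact intervalIntegral.continuous_parametric_intervalIntegral_of_continuous
      (f := fun (p : ℝ × ℝ) s => A (s, p.2) (W (s, p.2))) (by fun_prop) continuous_fst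
  have hhu : ∀ p, HasDerivAt (fun s => h (s, p.2)) (A p (W p)) p.1 := fun p => by
    have hc : Continuous fun s => A (s, p.2) (W (s, p.2)) := by fun_prop
    exact (intervalIntegral.integral_hasDerivAt_right (hc.intervalIntegrable p₀.1 p.1)
      (hc.stronglyMeasurableAtFilter _ _) hc.continuousAt).const_add (W (p₀.1, p.2))
  -- Compatibility replaces `A_v W + A B W` by `B_u W + B A W`. As `h_u = A W`, this is `(B h)_u +
  -- B_u (W - h)`, whose integral leaves only a term in `W - h` as the error in `h_v = B h`.
  have hhv : ∀ u ∈ Icc (p₀.1 - ρ) (p₀.1 + ρ), ∀ v ∈ Ioo (p₀.2 - ρ) (p₀.2 + ρ),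
      HasDerivAt (fun t => h (u, t)) (B (u, v) (h (u, v)) +
        ∫ s in p₀.1..u, du B (s, v) (W (s, v) - h (s, v))) v := fun u hu v hv => by
    have hsub := uIcc_subset_of_mem_Icc hu
    have h1 := (hWv p₀.1 hp₁ v hv).add (hasDerivAt_integral_snd (a := p₀.1) (b := u)
      (f := fun p => A p (W p)) (f' := fun p => dv A p (W p) + A p (B p (W p)))
      (by fun_prop) (by fun_prop) hv
      fun s hs t ht => hasDerivAt_clm_snd hA (hWv s (hsub hs) t ht))
    have h2 : ∫ s in p₀.1..u, (dv A (s, v) (W (s, v)) + A (s, v) (B (s, v) (W (s, v)))) =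
        ∫ s in p₀.1..u, ((du B (s, v) (h (s, v)) + B (s, v) (A (s, v) (W (s, v)))) +
          du B (s, v) (W (s, v) - h (s, v))) := by
      refine intervalIntegral.integral_congr fun s hs => ?_
      have := DFunLike.congr_fun (hcompat (s, v) (hρsub ⟨hsub hs, Ioo_subset_Icc_self hv⟩))
        (W (s, v))
      simp only [add_apply, ContinuousLinearMap.comp_apply] at this
      simp only [map_sub, this]
      abel
    have h3 : ∫ s in p₀.1..u, (du B (s, v) (h (s, v)) + B (s, v) (A (s, v) (W (s, v)))) =
        B (u, v) (h (u, v)) - B (p₀.1, v) (h (p₀.1, v)) :=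
      intervalIntegral.integral_eq_sub_of_hasDerivAt (f := fun s => B (s, v) (h (s, v)))
        (fun s _ => hasDerivAt_clm_fst hB (hhu (s, v)))
        (Continuous.intervalIntegrable (by fun_prop) _ _)
    have h4 : h (p₀.1, v) = W (p₀.1, v) := by simp [hh]
    refine h1.congr_deriv ?_
    rw [h2, intervalIntegral.integral_add (Continuous.intervalIntegrable (by fun_prop) _ _)
      (Continuous.intervalIntegrable (by fun_prop) _ _), h3, h4]
    abel
  have hIoo : Icc (p₀.2 - ρ / 2) (p₀.2 + ρ / 2) ⊆ Ioo (p₀.2 - ρ) (p₀.2 + ρ) :=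
    Icc_subset_Ioo (by linarith) (by linarith)
  have hIcc : Icc (p₀.1 - ρ / 2) (p₀.1 + ρ / 2) ⊆ Icc (p₀.1 - ρ) (p₀.1 + ρ) :=
    Icc_subset_Icc (by linarith) (by linarith)
  have hzero : ∀ p ∈ square p₀ (ρ / 2), W p - h p = 0 := by
    -- `W - h` vanishes on `v = v₀`, and its vertical derivative `B (W - h) - ∫ B_u (W - h)` is at
    -- most `C * S + C * S * (ρ / 2) ≤ 2 * C * S`.
    refine eq_zero_on_square (c := 2 * C) (D' := fun p => B p (W p) - (B p (h p) +
      ∫ s in p₀.1..p.1, du B (s, p.2) (W (s, p.2) - h (s, p.2))))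
      (by positivity) (hWc.sub hhc) ?_ ?_ ?_ (by nlinarith)
    · intro u hu
      simp [hWeq u (hIcc hu) p₀.2 hp₂, hWeq p₀.1 hp₁ p₀.2 hp₂, hh]
    · intro p hp
      exact (hWv p.1 (hIcc hp.1) p.2 (hIoo hp.2)).sub (hhv p.1 (hIcc hp.1) p.2 (hIoo hp.2))
    · intro S hS p hp
      have hsq := square_mono p₀ (show ρ / 2 ≤ ρ by linarith)
      have hS0 : 0 ≤ S := (norm_nonneg _).trans (hS p hp)
      have h1 : ‖B p (W p - h p)‖ ≤ C * S := (B p).le_of_opNorm_le_of_le (hBC p (hsq hp)) (hS p hp)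
      have h2 := norm_integral_clm_le (A := fun s => du B (s, p.2))
        (W := fun s => W (s, p.2) - h (s, p.2)) hp.1 (C := C) (K := S) (by linarith) hS0
        (fun t ht => hBuC _ (hsq ⟨ht, hp.2⟩)) fun t ht => hS _ ⟨ht, hp.2⟩
      have h3 : C * S * (ρ / 2) ≤ C * S :=
        mul_le_of_le_one_right (by positivity) (by linarith)
      rw [← sub_sub, ← map_sub]
      refine (norm_sub_le _ _).trans ?_
      linarith
  refine ⟨W, by simpa using hWeq p₀.1 hp₁ p₀.2 hp₂, fun p hp => ?_⟩
  have hnhds := mem_interior_iff_mem_nhds.1 hp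
  refine hasFDerivAt_of_partials (f₁ := fun p => A p (W p)) (f₂ := fun p => B p (W p))
    ?_ ?_ (by fun_prop) (by fun_prop)
  · filter_upwards [eventually_mem_nhds_iff.2 hnhds] with q hq
    refine (hhu q).congr_of_eventuallyEq ?_
    have : Continuous fun s : ℝ => (s, q.2) := by fun_prop
    filter_upwards [this.continuousAt.preimage_mem_nhds (x := q.1) hq] with s hs
    exact sub_eq_zero.1 (hzero _ hs)
  · filter_upwards [hnhds] with q hq
    exact hWv q.1 (hIcc hq.1) q.2 (hIoo hq.2)

/-- Bootstrapping: the system expresses the derivative of `w` through `w`, so each order of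
smoothness gives the next. -/
theorem contDiffOn_of_linear_system {A B : ℝ × ℝ → E →L[ℝ] E} (hA : ContDiff ℝ ∞ A)
    (hB : ContDiff ℝ ∞ B) {Q : Set (ℝ × ℝ)} (hQ : IsOpen Q) {w : ℝ × ℝ → E}
    (hw : ∀ p ∈ Q, HasFDerivAt w (gradMap (A p (w p)) (B p (w p))) p) : ContDiffOn ℝ ∞ w Q := by
  rw [contDiffOn_infty]
  intro n
  induction n with
  | zero => exact contDiffOn_zero.2 fun p hp => (hw p hp).continuousAt.continuousWithinAt
  | succ n ih =>
    push_cast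
    refine (contDiffOn_succ_iff_fderiv_of_isOpen (n := n) hQ).2
      ⟨fun p hp => (hw p hp).differentiableAt.differentiableWithinAt, by simp, ?_⟩
    have hA' : ContDiff ℝ n A := hA.of_le (by exact_mod_cast le_top)
    have hB' : ContDiff ℝ n B := hB.of_le (by exact_mod_cast le_top)
    refine (contDiff_gradMap.comp_contDiffOn ((hA'.contDiffOn.clm_apply ih).prodMk
      (hB'.contDiffOn.clm_apply ih))).congr fun p hp => (hw p hp).fderiv

end LorentzSurface

/-! ### Minkowski algebra, isotropic frames and the first integrals of the frame equations. -/

namespace LorentzSurface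

open Filter Topology

theorem mink_comm (a b : R31) : mink a b = mink b a := by
  simp only [mink]
  ring

@[simp]
theorem mink_add_left (a b c : R31) : mink (a + b) c = mink a c + mink b c := by
  simp only [mink, Pi.add_apply]
  ring

@[simp]
theorem mink_add_right (a b c : R31) : mink a (b + c) = mink a b + mink a c := by
  simp only [mink, Pi.add_apply]
  ring

@[simp]
theorem mink_smul_left (r : ℝ) (a b : R31) : mink (r • a) b = r * mink a b := by
  simp only [mink, Pi.smul_apply, smul_eq_mul]
  ring

@[simp]
theorem mink_smul_right (r : ℝ) (a b : R31) : mink a (r • b) = r * mink a b := by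
  simp only [mink, Pi.smul_apply, smul_eq_mul]
  ring

@[simp]
theorem mink_lcross_left (a b : R31) : mink (lcross a b) a = 0 := by
  simp [mink, lcross]
  ring

@[simp]
theorem mink_lcross_right (a b : R31) : mink (lcross a b) b = 0 := by
  simp [mink, lcross]
  ring

theorem mink_lcross_self (a b : R31) :
    mink (lcross a b) (lcross a b) = mink a b ^ 2 - mink a a * mink b b := by
  simp [mink, lcross]
  ring

/-- The expansion of `w` in `a`, `b`, `a × b`, cleared of the Gram determinant; as a polynomial
identity it needs no independence. -/
theorem mink_lcross_self_smul (a b w : R31) :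
    mink (lcross a b) (lcross a b) • w =
      (mink a b * mink w b - mink b b * mink w a) • a +
      (mink a b * mink w a - mink a a * mink w b) • b + mink w (lcross a b) • lcross a b := by
  ext i
  fin_cases i <;> simp [mink, lcross] <;> ring

variable {V : Type*} [NormedAddCommGroup V] [NormedSpace ℝ V]

theorem hasFDerivAt_coord {ι : Type*} [Fintype ι] {f : ℝ × ℝ → ι → ℝ} {p : ℝ × ℝ}
    {a b : ι → ℝ} (h : HasFDerivAt f (gradMap a b) p) (i : ι) :
    HasFDerivAt (fun q => f q i) (gradMap (a i) (b i)) p :=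
  ((hasFDerivAt_pi'.1 h) i).congr_fderiv (by ext <;> simp)

theorem hasFDerivAt_mink {f g : ℝ × ℝ → R31} {p : ℝ × ℝ} {a b c d : R31}
    (hf : HasFDerivAt f (gradMap a b) p) (hg : HasFDerivAt g (gradMap c d) p) :
    HasFDerivAt (fun q => mink (f q) (g q))
      (gradMap (mink a (g p) + mink (f p) c) (mink b (g p) + mink (f p) d)) p := by
  have hf' := hasFDerivAt_coord hf
  have hg' := hasFDerivAt_coord hg
  refine ((((hf' 0).mul (hg' 0)).neg.add ((hf' 1).mul (hg' 1))).add
    ((hf' 2).mul (hg' 2))).congr_fderiv ?_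
  ext <;> simp [mink] <;> ring

theorem hasFDerivAt_div {f g : ℝ × ℝ → ℝ} {p : ℝ × ℝ} {f' g' : ℝ × ℝ →L[ℝ] ℝ}
    (hf : HasFDerivAt f f' p) (hg : HasFDerivAt g g' p) (h0 : g p ≠ 0) :
    HasFDerivAt (fun q => f q / g q) ((g p)⁻¹ • f' - (f p / g p ^ 2) • g') p := by
  refine (hf.mul ((hasDerivAt_inv h0).comp_hasFDerivAt p hg)).congr_fderiv ?_
  ext <;> simp <;> ring

theorem _root_.ContDiffOn.mink {f g : ℝ × ℝ → R31} {D : Set (ℝ × ℝ)} (hf : ContDiffOn ℝ ∞ f D)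
    (hg : ContDiffOn ℝ ∞ g D) : ContDiffOn ℝ ∞ (fun p => mink (f p) (g p)) D := by
  have hf' := contDiffOn_pi.1 hf
  have hg' := contDiffOn_pi.1 hg
  exact (((hf' 0).mul (hg' 0)).neg.add ((hf' 1).mul (hg' 1))).add ((hf' 2).mul (hg' 2))

theorem _root_.ContDiffOn.lcross {f g : ℝ × ℝ → R31} {D : Set (ℝ × ℝ)} (hf : ContDiffOn ℝ ∞ f D)
    (hg : ContDiffOn ℝ ∞ g D) : ContDiffOn ℝ ∞ (fun p => lcross (f p) (g p)) D := by
  have hf' := contDiffOn_pi.1 hf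
  have hg' := contDiffOn_pi.1 hg
  refine contDiffOn_pi.2 fun i => ?_
  fin_cases i
  · exact (((hf' 1).mul (hg' 2)).sub ((hf' 2).mul (hg' 1))).neg
  · exact ((hf' 2).mul (hg' 0)).sub ((hf' 0).mul (hg' 2))
  · exact ((hf' 0).mul (hg' 1)).sub ((hf' 1).mul (hg' 0))

/-- Two isotropic vectors `a`, `b` with `⟨a, b⟩ = F > 0` and the unit normal `l` of the plane
they span. -/
structure IsIsotropicFrame (F : ℝ) (a b l : R31) : Prop where
  pos : 0 < F
  aa : mink a a = 0
  bb : mink b b = 0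
  ab : mink a b = F
  cross : lcross a b = F • l

namespace IsIsotropicFrame

variable {F : ℝ} {a b l : R31} (h : IsIsotropicFrame F a b l)
include h

theorem normal_eq : l = F⁻¹ • lcross a b := by
  rw [h.cross, smul_smul, inv_mul_cancel₀ h.pos.ne', one_smul]

theorem ba : mink b a = F := by rw [mink_comm, h.ab]

theorem la : mink l a = 0 := by simp [h.normal_eq]

theorem lb : mink l b = 0 := by simp [h.normal_eq]

theorem al : mink a l = 0 := by rw [mink_comm, h.la]

theorem bl : mink b l = 0 := by rw [mink_comm, h.lb]

theorem ll : mink l l = 1 := by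
  have := h.pos.ne'
  rw [h.normal_eq, mink_smul_left, mink_smul_right, mink_lcross_self, h.ab, h.aa]
  field_simp
  simp

/-- The basis dual to `a`, `b`, `l` is `b / F`, `a / F`, `l`, which explains the exchange of `a` and
`b` in the coefficients. -/
theorem expand (w : R31) :
    w = (mink w b / F) • a + (mink w a / F) • b + mink w l • l := by
  have hF := h.pos.ne'
  have h1 := mink_lcross_self_smul a b w
  rw [mink_lcross_self, h.ab, h.aa, h.bb, h.cross, mink_smul_right] at h1
  have h2 : w = (F ^ 2)⁻¹ • ((F ^ 2 - 0 * 0) • w) := by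
    rw [smul_smul, mul_zero, sub_zero, inv_mul_cancel₀ (pow_ne_zero 2 hF), one_smul]
  refine h2.trans ?_
  rw [h1]
  simp only [smul_add, smul_smul]
  congr 3 <;> field_simp <;> ring

theorem mink_eq (w z : R31) :
    mink w z = (mink w b * mink z a + mink w a * mink z b) / F + mink w l * mink z l := by
  conv_lhs => rw [h.expand w]
  simp only [mink_add_left, mink_smul_left]
  rw [mink_comm a z, mink_comm b z, mink_comm l z]
  ring

theorem det_eq : Matrix.det (Matrix.of ![a, b, l]) = F := by
  rw [← mink_lcross, h.cross, mink_smul_left, h.ll, mul_one]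

end IsIsotropicFrame

/-- The moving frame equations of a surface in isotropic coordinates, for vector valued or
scalar functions `a`, `b`, `l` on `D`. -/
structure FrameEqs (D : Set (ℝ × ℝ)) (F L M N : ℝ × ℝ → ℝ) (a b l : ℝ × ℝ → V) : Prop where
  da : ∀ p ∈ D, HasFDerivAt a (gradMap ((du F p / F p) • a p + L p • l p) (M p • l p)) p
  db : ∀ p ∈ D, HasFDerivAt b (gradMap (M p • l p) ((dv F p / F p) • b p + N p • l p)) p
  dl : ∀ p ∈ D, HasFDerivAt l (gradMap (-(M p / F p) • a p - (L p / F p) • b p)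
    (-(N p / F p) • a p - (M p / F p) • b p)) p

theorem FrameEqs.congr {D : Set (ℝ × ℝ)} {F L M N F' L' M' N' : ℝ × ℝ → ℝ} {a b l : ℝ × ℝ → V}
    (hD : IsOpen D) (h : FrameEqs D F L M N a b l) (hF : EqOn F F' D) (hL : EqOn L L' D)
    (hM : EqOn M M' D) (hN : EqOn N N' D) : FrameEqs D F' L' M' N' a b l where
  da p hp := by
    rw [← hF hp, ← hL hp, ← hM hp, ← du_congr hD hF hp]
    exact h.da p hp
  db p hp := by
    rw [← hF hp, ← hN hp, ← hM hp, ← dv_congr hD hF hp]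
    exact h.db p hp
  dl p hp := by
    rw [← hF hp, ← hN hp, ← hM hp, ← hL hp]
    exact h.dl p hp

/-- The coefficients are scalar, so the system acts on each coordinate separately; this lets scalar
solutions from different coordinates, or from different surfaces, be paired. -/
theorem FrameEqs.coord {D : Set (ℝ × ℝ)} {F L M N : ℝ × ℝ → ℝ} {a b l : ℝ × ℝ → R31}
    (h : FrameEqs D F L M N a b l) (i : Fin 3) :
    FrameEqs D F L M N (fun p => a p i) (fun p => b p i) (fun p => l p i) where
  da p hp := hasFDerivAt_coord (h.da p hp) i
  db p hp := hasFDerivAt_coord (h.db p hp) i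
  dl p hp := hasFDerivAt_coord (h.dl p hp) i

theorem eq_of_hasFDerivAt_zero {D : Set (ℝ × ℝ)} (hD : IsOpen D) (hc : IsPreconnected D)
    {f : ℝ × ℝ → V} (hf : ∀ p ∈ D, HasFDerivAt f (0 : ℝ × ℝ →L[ℝ] V) p) {p q : ℝ × ℝ}
    (hp : p ∈ D) (hq : q ∈ D) : f p = f q :=
  hD.is_const_of_fderiv_eq_zero (𝕜 := ℝ) hc
    (fun p hp => (hf p hp).differentiableAt.differentiableWithinAt) (fun p hp => (hf p hp).fderiv)
    hp hq

/-- The bilinear pairing of two scalar solutions of the frame equations is constant. -/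
theorem FrameEqs.pairing_eq {D : Set (ℝ × ℝ)} (hD : IsOpen D) (hc : IsPreconnected D)
    {F L M N : ℝ × ℝ → ℝ} (hF : ∀ p ∈ D, DifferentiableAt ℝ F p) (hF0 : ∀ p ∈ D, 0 < F p)
    {a b l a' b' l' : ℝ × ℝ → ℝ} (h : FrameEqs D F L M N a b l)
    (h' : FrameEqs D F L M N a' b' l') {p q : ℝ × ℝ} (hp : p ∈ D) (hq : q ∈ D) :
    (a' p * b p + b' p * a p) / F p + l' p * l p =
      (a' q * b q + b' q * a q) / F q + l' q * l q := by
  refine eq_of_hasFDerivAt_zero hD hc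
    (f := fun p => (a' p * b p + b' p * a p) / F p + l' p * l p) (fun p hp => ?_) hp hq
  have h0 := (hF0 p hp).ne'
  -- Differentiating `1 / F` cancels the terms in `F_u` and `F_v`; the terms in `L`, `M`, `N` cancel
  -- against the derivative of `l' l`.
  refine ((hasFDerivAt_div (((h'.da p hp).mul (h.db p hp)).add ((h'.db p hp).mul (h.da p hp)))
    (hF p hp).hasFDerivAt_gradMap h0).add ((h'.dl p hp).mul (h.dl p hp))).congr_fderiv ?_
  ext <;> simp <;> field_simp <;> ring

/-- The normalised determinant of three scalar solutions of the frame equations is constant. -/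
theorem FrameEqs.det_eq {D : Set (ℝ × ℝ)} (hD : IsOpen D) (hc : IsPreconnected D)
    {F L M N : ℝ × ℝ → ℝ} (hF : ∀ p ∈ D, DifferentiableAt ℝ F p) (hF0 : ∀ p ∈ D, 0 < F p)
    {a b l : ℝ × ℝ → R31} (h : FrameEqs D F L M N a b l)
    {p q : ℝ × ℝ} (hp : p ∈ D) (hq : q ∈ D) :
    mink (lcross (a p) (b p)) (l p) / F p = mink (lcross (a q) (b q)) (l q) / F q := by
  -- Liouville's formula: the two coefficient matrices have traces `F_u / F` and `F_v / F`, so the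
  -- determinant varies proportionally to `F`.
  refine eq_of_hasFDerivAt_zero hD hc
    (f := fun p => mink (lcross (a p) (b p)) (l p) / F p) (fun p hp => ?_) hp hq
  have h0 := (hF0 p hp).ne'
  have ha := fun i => (h.coord i).da p hp
  have hb := fun i => (h.coord i).db p hp
  have hl := fun i => (h.coord i).dl p hp
  have hm : ∀ i j, HasFDerivAt (fun q => a q i * b q j - a q j * b q i) _ p := fun i j =>
    ((ha i).mul (hb j)).sub ((ha j).mul (hb i))
  have hfun : (fun p => mink (lcross (a p) (b p)) (l p) / F p) = fun p =>
      ((a p 1 * b p 2 - a p 2 * b p 1) * l p 0 + (a p 2 * b p 0 - a p 0 * b p 2) * l p 1 +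
        (a p 0 * b p 1 - a p 1 * b p 0) * l p 2) / F p := by
    funext p
    simp [mink, lcross]
    ring
  rw [hfun]
  refine (hasFDerivAt_div ((((hm 1 2).mul (hl 0)).add ((hm 2 0).mul (hl 1))).add
    ((hm 0 1).mul (hl 2))) (hF p hp).hasFDerivAt_gradMap h0).congr_fderiv ?_
  ext <;> simp <;> field_simp <;> ring

end LorentzSurface

/-! ### From a canonical surface to the natural equation. -/

namespace LorentzSurface

open Filter Topology

theorem du_eq_zero_of_const {V : Type*} [NormedAddCommGroup V] [NormedSpace ℝ V]
    {D : Set (ℝ × ℝ)} (hD : IsOpen D) {f : ℝ × ℝ → V} {c : V} (h : ∀ p ∈ D, f p = c) {p : ℝ × ℝ}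
    (hp : p ∈ D) : du f p = 0 := by
  rw [du_congr hD (show EqOn f (fun _ => c) D from h) hp]
  simp [du]

theorem dv_eq_zero_of_const {V : Type*} [NormedAddCommGroup V] [NormedSpace ℝ V]
    {D : Set (ℝ × ℝ)} (hD : IsOpen D) {f : ℝ × ℝ → V} {c : V} (h : ∀ p ∈ D, f p = c) {p : ℝ × ℝ}
    (hp : p ∈ D) : dv f p = 0 := by
  rw [dv_congr hD (show EqOn f (fun _ => c) D from h) hp]
  simp [dv]

theorem du_mink {f g : ℝ × ℝ → R31} {p : ℝ × ℝ} (hf : DifferentiableAt ℝ f p)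
    (hg : DifferentiableAt ℝ g p) :
    du (fun q => mink (f q) (g q)) p = mink (du f p) (g p) + mink (f p) (du g p) :=
  du_eq_of_hasFDerivAt (hasFDerivAt_mink hf.hasFDerivAt_gradMap hg.hasFDerivAt_gradMap)

theorem dv_mink {f g : ℝ × ℝ → R31} {p : ℝ × ℝ} (hf : DifferentiableAt ℝ f p)
    (hg : DifferentiableAt ℝ g p) :
    dv (fun q => mink (f q) (g q)) p = mink (dv f p) (g p) + mink (f p) (dv g p) :=
  dv_eq_of_hasFDerivAt (hasFDerivAt_mink hf.hasFDerivAt_gradMap hg.hasFDerivAt_gradMap)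

theorem du_mul {f g : ℝ × ℝ → ℝ} {p : ℝ × ℝ} (hf : DifferentiableAt ℝ f p)
    (hg : DifferentiableAt ℝ g p) :
    du (fun q => f q * g q) p = f p * du g p + g p * du f p := by
  simp [du, fderiv_fun_mul hf hg]

theorem dv_mul {f g : ℝ × ℝ → ℝ} {p : ℝ × ℝ} (hf : DifferentiableAt ℝ f p)
    (hg : DifferentiableAt ℝ g p) :
    dv (fun q => f q * g q) p = f p * dv g p + g p * dv f p := by
  simp [dv, fderiv_fun_mul hf hg]

section Isotropic

variable {x : ℝ × ℝ → R31} {p : ℝ × ℝ}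

theorem normal_eq_of_isotropic (hE : coeffE x p = 0) (hF : 0 < coeffF x p) :
    normal x p = (coeffF x p)⁻¹ • lcross (du x p) (dv x p) := by
  rw [normal, mink_lcross_self]
  simp only [coeffE, coeffF] at *
  rw [hE, zero_mul, sub_zero, abs_of_nonneg (sq_nonneg _), Real.sqrt_sq hF.le]

theorem isIsotropicFrame_of_isotropic (hE : coeffE x p = 0) (hG : coeffG x p = 0)
    (hF : 0 < coeffF x p) : IsIsotropicFrame (coeffF x p) (du x p) (dv x p) (normal x p) where
  pos := hF
  aa := hE
  bb := hG
  ab := rfl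
  cross := by
    rw [normal_eq_of_isotropic hE hF, smul_smul, mul_inv_cancel₀ hF.ne', one_smul]

theorem meanH_of_isotropic (hE : coeffE x p = 0) (hG : coeffG x p = 0) (hF : 0 < coeffF x p) :
    meanH x p = coeffM x p / coeffF x p := by
  have := hF.ne'
  rw [meanH, hE, hG]
  field_simp
  ring

theorem general_of_isotropic (hE : coeffE x p = 0) (hG : coeffG x p = 0) (hF : 0 < coeffF x p) :
    meanH x p ^ 2 - gaussK x p = coeffL x p * coeffN x p / coeffF x p ^ 2 := by
  have := hF.ne'
  rw [meanH_of_isotropic hE hG hF, gaussK, hE, hG]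
  field_simp
  ring

end Isotropic

namespace IsCanonical

variable {D : Set (ℝ × ℝ)} {x : ℝ × ℝ → R31} {p₀ : ℝ × ℝ} {ε₁ ε₂ : ℝ}
  (h : IsCanonical D x p₀ ε₁ ε₂)
include h

theorem frame {p : ℝ × ℝ} (hp : p ∈ D) :
    IsIsotropicFrame (coeffF x p) (du x p) (dv x p) (normal x p) :=
  isIsotropicFrame_of_isotropic (h.isotropicE p hp) (h.isotropicG p hp) (h.posF p hp)

theorem smooth_du : ContDiffOn ℝ ∞ (du x) D := h.smooth.du h.isOpen

theorem smooth_dv : ContDiffOn ℝ ∞ (dv x) D := h.smooth.dv h.isOpen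

theorem smoothF : ContDiffOn ℝ ∞ (coeffF x) D := h.smooth_du.mink h.smooth_dv

theorem smooth_normal : ContDiffOn ℝ ∞ (normal x) D :=
  ((h.smoothF.inv fun p hp => (h.posF p hp).ne').smul (h.smooth_du.lcross h.smooth_dv)).congr
    fun p hp => normal_eq_of_isotropic (h.isotropicE p hp) (h.posF p hp)

theorem smoothL : ContDiffOn ℝ ∞ (coeffL x) D := (h.smooth_du.du h.isOpen).mink h.smooth_normal

theorem smoothM : ContDiffOn ℝ ∞ (coeffM x) D := (h.smooth_du.dv h.isOpen).mink h.smooth_normal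

theorem smoothN : ContDiffOn ℝ ∞ (coeffN x) D := (h.smooth_dv.dv h.isOpen).mink h.smooth_normal

theorem meanH_eq {p : ℝ × ℝ} (hp : p ∈ D) : meanH x p = coeffM x p / coeffF x p :=
  meanH_of_isotropic (h.isotropicE p hp) (h.isotropicG p hp) (h.posF p hp)

theorem smoothH : ContDiffOn ℝ ∞ (meanH x) D :=
  (h.smoothM.div h.smoothF fun p hp => (h.posF p hp).ne').congr fun _ hp => h.meanH_eq hp

theorem coeffM_eq {p : ℝ × ℝ} (hp : p ∈ D) : coeffM x p = coeffF x p * meanH x p := by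
  rw [h.meanH_eq hp, mul_div_cancel₀ _ (h.posF p hp).ne']

theorem du_dv {p : ℝ × ℝ} (hp : p ∈ D) : du (dv x) p = dv (du x) p :=
  du_dv_comm (h.smooth.contDiffAt (h.isOpen.mem_nhds hp))

/-- This and the next five lemmas differentiate `E = 0`, `G = 0` and the definition of `F` to find
the tangential parts of the second derivatives. -/
theorem mink_uu_u {p : ℝ × ℝ} (hp : p ∈ D) : mink (du (du x) p) (du x p) = 0 := by
  have ha := h.smooth_du.differentiableAt_of_isOpen h.isOpen hp
  have h1 := du_eq_zero_of_const h.isOpen h.isotropicE hp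
  have h2 : du (coeffE x) p = _ := du_mink ha ha
  rw [h2, mink_comm (du x p)] at h1
  linarith

theorem mink_uv_u {p : ℝ × ℝ} (hp : p ∈ D) : mink (dv (du x) p) (du x p) = 0 := by
  have ha := h.smooth_du.differentiableAt_of_isOpen h.isOpen hp
  have h1 := dv_eq_zero_of_const h.isOpen h.isotropicE hp
  have h2 : dv (coeffE x) p = _ := dv_mink ha ha
  rw [h2, mink_comm (du x p)] at h1
  linarith

theorem mink_uv_v {p : ℝ × ℝ} (hp : p ∈ D) : mink (dv (du x) p) (dv x p) = 0 := by
  have ha := h.smooth_dv.differentiableAt_of_isOpen h.isOpen hp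
  have h1 := du_eq_zero_of_const h.isOpen h.isotropicG hp
  have h2 : du (coeffG x) p = _ := du_mink ha ha
  rw [h2, mink_comm (dv x p), h.du_dv hp] at h1
  linarith

theorem mink_vv_v {p : ℝ × ℝ} (hp : p ∈ D) : mink (dv (dv x) p) (dv x p) = 0 := by
  have ha := h.smooth_dv.differentiableAt_of_isOpen h.isOpen hp
  have h1 := dv_eq_zero_of_const h.isOpen h.isotropicG hp
  have h2 : dv (coeffG x) p = _ := dv_mink ha ha
  rw [h2, mink_comm (dv x p)] at h1
  linarith

theorem mink_uu_v {p : ℝ × ℝ} (hp : p ∈ D) : mink (du (du x) p) (dv x p) = du (coeffF x) p := by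
  have ha := h.smooth_du.differentiableAt_of_isOpen h.isOpen hp
  have hb := h.smooth_dv.differentiableAt_of_isOpen h.isOpen hp
  have h2 : du (coeffF x) p = _ := du_mink ha hb
  rw [h2, mink_comm (du x p), h.du_dv hp, h.mink_uv_u hp, add_zero]

theorem mink_vv_u {p : ℝ × ℝ} (hp : p ∈ D) : mink (dv (dv x) p) (du x p) = dv (coeffF x) p := by
  have ha := h.smooth_du.differentiableAt_of_isOpen h.isOpen hp
  have hb := h.smooth_dv.differentiableAt_of_isOpen h.isOpen hp
  have h2 : dv (coeffF x) p = _ := dv_mink ha hb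
  rw [h2, mink_comm (du x p), h.mink_uv_v hp, zero_add]

theorem du_du_eq {p : ℝ × ℝ} (hp : p ∈ D) :
    du (du x) p = (du (coeffF x) p / coeffF x p) • du x p + coeffL x p • normal x p := by
  conv_lhs => rw [(h.frame hp).expand (du (du x) p), h.mink_uu_v hp, h.mink_uu_u hp]
  simp [coeffL]

theorem dv_du_eq {p : ℝ × ℝ} (hp : p ∈ D) : dv (du x) p = coeffM x p • normal x p := by
  conv_lhs => rw [(h.frame hp).expand (dv (du x) p), h.mink_uv_v hp, h.mink_uv_u hp]
  simp [coeffM]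

theorem dv_dv_eq {p : ℝ × ℝ} (hp : p ∈ D) :
    dv (dv x) p = (dv (coeffF x) p / coeffF x p) • dv x p + coeffN x p • normal x p := by
  conv_lhs => rw [(h.frame hp).expand (dv (dv x) p), h.mink_vv_v hp, h.mink_vv_u hp]
  simp [coeffN]

/-- Differentiating `⟨l, x_u⟩ = ⟨l, x_v⟩ = 0` and `⟨l, l⟩ = 1` moves every derivative of `l` onto
`x`. -/
theorem du_normal_eq {p : ℝ × ℝ} (hp : p ∈ D) : du (normal x) p =
    -(coeffM x p / coeffF x p) • du x p - (coeffL x p / coeffF x p) • dv x p := by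
  have ha := h.smooth_du.differentiableAt_of_isOpen h.isOpen hp
  have hb := h.smooth_dv.differentiableAt_of_isOpen h.isOpen hp
  have hl := h.smooth_normal.differentiableAt_of_isOpen h.isOpen hp
  have h1 := du_eq_zero_of_const h.isOpen (fun q hq => (h.frame hq).la) hp
  have h2 := du_eq_zero_of_const h.isOpen (fun q hq => (h.frame hq).lb) hp
  have h3 := du_eq_zero_of_const h.isOpen (fun q hq => (h.frame hq).ll) hp
  rw [du_mink hl ha, mink_comm (normal x p)] at h1
  rw [du_mink hl hb, mink_comm (normal x p), h.du_dv hp] at h2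
  rw [du_mink hl hl, mink_comm (normal x p)] at h3
  conv_lhs => rw [(h.frame hp).expand (du (normal x) p), show mink (du (normal x) p) (normal x p) =
    0 by linarith, eq_neg_of_add_eq_zero_left h1, eq_neg_of_add_eq_zero_left h2]
  simp only [coeffL, coeffM, zero_smul, add_zero, neg_div, neg_smul, sub_eq_add_neg]

theorem dv_normal_eq {p : ℝ × ℝ} (hp : p ∈ D) : dv (normal x) p =
    -(coeffN x p / coeffF x p) • du x p - (coeffM x p / coeffF x p) • dv x p := by
  have ha := h.smooth_du.differentiableAt_of_isOpen h.isOpen hp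
  have hb := h.smooth_dv.differentiableAt_of_isOpen h.isOpen hp
  have hl := h.smooth_normal.differentiableAt_of_isOpen h.isOpen hp
  have h1 := dv_eq_zero_of_const h.isOpen (fun q hq => (h.frame hq).la) hp
  have h2 := dv_eq_zero_of_const h.isOpen (fun q hq => (h.frame hq).lb) hp
  have h3 := dv_eq_zero_of_const h.isOpen (fun q hq => (h.frame hq).ll) hp
  rw [dv_mink hl ha, mink_comm (normal x p)] at h1
  rw [dv_mink hl hb, mink_comm (normal x p)] at h2
  rw [dv_mink hl hl, mink_comm (normal x p)] at h3
  conv_lhs => rw [(h.frame hp).expand (dv (normal x) p), show mink (dv (normal x) p) (normal x p) =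
    0 by linarith, eq_neg_of_add_eq_zero_left h1, eq_neg_of_add_eq_zero_left h2]
  simp only [coeffN, coeffM, zero_smul, add_zero, neg_div, neg_smul, sub_eq_add_neg]

theorem frameEqs : FrameEqs D (coeffF x) (coeffL x) (coeffM x) (coeffN x) (du x) (dv x)
    (normal x) where
  da p hp := by
    rw [← h.du_du_eq hp, ← h.dv_du_eq hp]
    exact (h.smooth_du.differentiableAt_of_isOpen h.isOpen hp).hasFDerivAt_gradMap
  db p hp := by
    rw [← h.dv_dv_eq hp, ← h.dv_du_eq hp, ← h.du_dv hp]
    exact (h.smooth_dv.differentiableAt_of_isOpen h.isOpen hp).hasFDerivAt_gradMap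
  dl p hp := by
    rw [← h.du_normal_eq hp, ← h.dv_normal_eq hp]
    exact (h.smooth_normal.differentiableAt_of_isOpen h.isOpen hp).hasFDerivAt_gradMap

/-- A Codazzi equation. `L_v` and `M_u` share the term `⟨x_uuv, l⟩`; the rest gives `L_v - M_u = -H
F_u`, while `M = F H` gives `M_u = F H_u + H F_u`. -/
theorem dv_coeffL {p : ℝ × ℝ} (hp : p ∈ D) :
    dv (coeffL x) p = coeffF x p * du (meanH x) p := by
  have hl := h.smooth_normal.differentiableAt_of_isOpen h.isOpen hp
  have hF := h.smoothF.differentiableAt_of_isOpen h.isOpen hp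
  have hH := h.smoothH.differentiableAt_of_isOpen h.isOpen hp
  have huu := (h.smooth_du.du h.isOpen).differentiableAt_of_isOpen h.isOpen hp
  have huv := (h.smooth_du.dv h.isOpen).differentiableAt_of_isOpen h.isOpen hp
  have h1 : dv (coeffL x) p = _ := dv_mink huu hl
  have h2 : du (coeffM x) p = _ := du_mink huv hl
  have h3 := du_congr h.isOpen (fun q hq => h.coeffM_eq hq) hp
  rw [du_mul hF hH] at h3
  have h4 : du (dv (du x)) p = dv (du (du x)) p :=
    du_dv_comm (h.smooth_du.contDiffAt (h.isOpen.mem_nhds hp))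
  have h5 : mink (du (du x) p) (dv (normal x) p) = -(meanH x p * du (coeffF x) p) := by
    rw [h.dv_normal_eq hp, sub_eq_add_neg, ← neg_smul, mink_add_right, mink_smul_right,
      mink_smul_right, h.mink_uu_u hp, h.mink_uu_v hp, h.meanH_eq hp]
    ring
  have h6 : mink (dv (du x) p) (du (normal x) p) = 0 := by
    rw [h.du_normal_eq hp, sub_eq_add_neg, ← neg_smul, mink_add_right, mink_smul_right,
      mink_smul_right, h.mink_uv_u hp, h.mink_uv_v hp]
    ring
  rw [h5] at h1
  rw [h6, h4] at h2
  linarith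

theorem du_coeffN {p : ℝ × ℝ} (hp : p ∈ D) :
    du (coeffN x) p = coeffF x p * dv (meanH x) p := by
  have hl := h.smooth_normal.differentiableAt_of_isOpen h.isOpen hp
  have hF := h.smoothF.differentiableAt_of_isOpen h.isOpen hp
  have hH := h.smoothH.differentiableAt_of_isOpen h.isOpen hp
  have hvv := (h.smooth_dv.dv h.isOpen).differentiableAt_of_isOpen h.isOpen hp
  have huv := (h.smooth_du.dv h.isOpen).differentiableAt_of_isOpen h.isOpen hp
  have h1 : du (coeffN x) p = _ := du_mink hvv hl
  have h2 : dv (coeffM x) p = _ := dv_mink huv hl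
  have h3 := dv_congr h.isOpen (fun q hq => h.coeffM_eq hq) hp
  rw [dv_mul hF hH] at h3
  have h4 : du (dv (dv x)) p = dv (dv (du x)) p :=
    (du_dv_comm (h.smooth_dv.contDiffAt (h.isOpen.mem_nhds hp))).trans
      (dv_congr h.isOpen (fun q hq => h.du_dv hq) hp)
  have h5 : mink (dv (dv x) p) (du (normal x) p) = -(meanH x p * dv (coeffF x) p) := by
    rw [h.du_normal_eq hp, sub_eq_add_neg, ← neg_smul, mink_add_right, mink_smul_right,
      mink_smul_right, h.mink_vv_u hp, h.mink_vv_v hp, h.meanH_eq hp]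
    ring
  have h6 : mink (dv (du x) p) (dv (normal x) p) = 0 := by
    rw [h.dv_normal_eq hp, sub_eq_add_neg, ← neg_smul, mink_add_right, mink_smul_right,
      mink_smul_right, h.mink_uv_u hp, h.mink_uv_v hp]
    ring
  rw [h5, h4] at h1
  rw [h6] at h2
  linarith

/-- Differentiate `F_u = ⟨x_uu, x_v⟩` in `v` and `⟨x_uv, x_v⟩ = 0` in `u`, and eliminate `⟨x_uuv,
x_v⟩`: this leaves `F_uv = ⟨x_uu, x_vv⟩ - ⟨x_uv, x_uv⟩ = F_u F_v / F + L N - M²`. -/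
theorem gauss_equation {p : ℝ × ℝ} (hp : p ∈ D) :
    (coeffF x p * dv (du (coeffF x)) p - du (coeffF x) p * dv (coeffF x) p) / coeffF x p =
      coeffL x p * coeffN x p - coeffF x p ^ 2 * meanH x p ^ 2 := by
  have hb := h.smooth_dv.differentiableAt_of_isOpen h.isOpen hp
  have huu := (h.smooth_du.du h.isOpen).differentiableAt_of_isOpen h.isOpen hp
  have huv := (h.smooth_du.dv h.isOpen).differentiableAt_of_isOpen h.isOpen hp
  have hfr := h.frame hp
  have h1 := dv_congr h.isOpen (fun q hq => h.mink_uu_v hq) hp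
  have h2 := du_eq_zero_of_const h.isOpen (fun q hq => h.mink_uv_v hq) hp
  rw [dv_mink huu hb] at h1
  rw [du_mink huv hb, h.du_dv hp, du_dv_comm (h.smooth_du.contDiffAt (h.isOpen.mem_nhds hp))] at h2
  have h3 : mink (dv (du x) p) (dv (du x) p) = coeffM x p ^ 2 := by
    rw [h.dv_du_eq hp, mink_smul_left, mink_smul_right, hfr.ll]
    ring
  have h4 : mink (du (du x) p) (dv (dv x) p) =
      du (coeffF x) p * dv (coeffF x) p / coeffF x p + coeffL x p * coeffN x p := by
    rw [h.dv_dv_eq hp, mink_add_right, mink_smul_right, mink_smul_right, h.mink_uu_v hp, coeffL]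
    ring
  have h5 : dv (du (coeffF x)) p = du (coeffF x) p * dv (coeffF x) p / coeffF x p +
      coeffL x p * coeffN x p - coeffM x p ^ 2 := by linarith
  have := hfr.pos.ne'
  rw [h5, h.coeffM_eq hp]
  field_simp
  ring

theorem coeffL_eq_integral {u v : ℝ} (hs : ∀ s ∈ uIcc p₀.2 v, (u, s) ∈ D) :
    coeffL x (u, v) = ε₁ + ∫ s in p₀.2..v, coeffF x (u, s) * du (meanH x) (u, s) := by
  have hmaps : MapsTo (fun s : ℝ => (u, s)) (uIcc p₀.2 v) D := hs
  have hc : ContinuousOn (fun s : ℝ => (u, s)) (uIcc p₀.2 v) := by fun_prop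
  rw [intervalIntegral.integral_eq_sub_of_hasDerivAt (f := fun s => coeffL x (u, s)),
    h.canonicalL u (hs _ left_mem_uIcc), add_sub_cancel]
  · intro s hs'
    rw [← h.dv_coeffL (hs s hs')]
    exact hasDerivAt_snd_of_hasFDerivAt (p := (u, s))
      (h.smoothL.differentiableAt_of_isOpen h.isOpen (hs s hs')).hasFDerivAt_gradMap
  · exact ((h.smoothF.continuousOn.comp hc hmaps).mul
      ((h.smoothH.du h.isOpen).continuousOn.comp hc hmaps)).intervalIntegrable

theorem coeffN_eq_integral {u v : ℝ} (hs : ∀ s ∈ uIcc p₀.1 u, (s, v) ∈ D) :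
    coeffN x (u, v) = ε₂ + ∫ s in p₀.1..u, coeffF x (s, v) * dv (meanH x) (s, v) := by
  have hmaps : MapsTo (fun s : ℝ => (s, v)) (uIcc p₀.1 u) D := hs
  have hc : ContinuousOn (fun s : ℝ => (s, v)) (uIcc p₀.1 u) := by fun_prop
  rw [intervalIntegral.integral_eq_sub_of_hasDerivAt (f := fun s => coeffN x (s, v)),
    h.canonicalN v (hs _ left_mem_uIcc), add_sub_cancel]
  · intro s hs'
    rw [← h.du_coeffN (hs s hs')]
    exact hasDerivAt_fst_of_hasFDerivAt (p := (s, v))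
      (h.smoothN.differentiableAt_of_isOpen h.isOpen (hs s hs')).hasFDerivAt_gradMap
  · exact ((h.smoothF.continuousOn.comp hc hmaps).mul
      ((h.smoothH.dv h.isOpen).continuousOn.comp hc hmaps)).intervalIntegrable

theorem isNaturalSolution : IsNaturalSolution D p₀ ε₁ ε₂ (coeffF x) (meanH x) where
  smoothF := h.smoothF
  smoothH := h.smoothH
  posF := h.posF
  equation u v hu hv := by
    rw [← h.coeffL_eq_integral hu, ← h.coeffN_eq_integral hv]
    exact h.gauss_equation (hu v right_mem_uIcc)

end IsCanonical

/-! ### Proper motions: invariance of the coefficients, and uniqueness. -/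

section Motion

theorem det_mulVec (A : Matrix (Fin 3) (Fin 3) ℝ) (a b c : R31) :
    Matrix.det (Matrix.of ![A *ᵥ a, A *ᵥ b, A *ᵥ c]) =
      A.det * Matrix.det (Matrix.of ![a, b, c]) := by
  have : Matrix.of ![A *ᵥ a, A *ᵥ b, A *ᵥ c] = Matrix.of ![a, b, c] * Aᵀ := by
    ext i j
    fin_cases i <;>
      simp [Matrix.mul_apply, Matrix.mulVec, dotProduct, Fin.sum_univ_three] <;> ring
  rw [this, Matrix.det_mul, Matrix.det_transpose, mul_comm]

theorem hasFDerivAt_mulVec {f : ℝ × ℝ → R31} {p : ℝ × ℝ} (A : Matrix (Fin 3) (Fin 3) ℝ)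
    (hf : DifferentiableAt ℝ f p) (b : R31) :
    HasFDerivAt (fun q => A *ᵥ f q + b) (gradMap (A *ᵥ du f p) (A *ᵥ dv f p)) p := by
  have := (((A.mulVecLin.toContinuousLinearMap).hasFDerivAt (x := f p)).comp p
    hf.hasFDerivAt_gradMap).add_const b
  refine this.congr_fderiv ?_
  ext : 2 <;> simp

theorem du_mulVec {D : Set (ℝ × ℝ)} (hD : IsOpen D) (A : Matrix (Fin 3) (Fin 3) ℝ) {b : R31}
    {f g : ℝ × ℝ → R31} (hf : ContDiffOn ℝ ∞ f D) (hg : ∀ p ∈ D, g p = A *ᵥ f p + b) :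
    ∀ p ∈ D, du g p = A *ᵥ du f p := fun p hp => by
  rw [du_congr hD hg hp]
  exact du_eq_of_hasFDerivAt (hasFDerivAt_mulVec A (hf.differentiableAt_of_isOpen hD hp) b)

theorem dv_mulVec {D : Set (ℝ × ℝ)} (hD : IsOpen D) (A : Matrix (Fin 3) (Fin 3) ℝ) {b : R31}
    {f g : ℝ × ℝ → R31} (hf : ContDiffOn ℝ ∞ f D) (hg : ∀ p ∈ D, g p = A *ᵥ f p + b) :
    ∀ p ∈ D, dv g p = A *ᵥ dv f p := fun p hp => by
  rw [dv_congr hD hg hp]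
  exact dv_eq_of_hasFDerivAt (hasFDerivAt_mulVec A (hf.differentiableAt_of_isOpen hD hp) b)

variable {A : Matrix (Fin 3) (Fin 3) ℝ} (hA : ∀ y z : R31, mink (A *ᵥ y) (A *ᵥ z) = mink y z)
  (hdet : A.det = 1)

include hA hdet

/-- Both sides have the same product with every `A z`, because `det (A a, A b, A z) = det (a, b,
z)`; `A` is onto and the form is nondegenerate. The determinant condition fixes the direction of the
normal here. -/
theorem lcross_mulVec (a b : R31) : lcross (A *ᵥ a) (A *ᵥ b) = A *ᵥ lcross a b := by
  have hunit : IsUnit A.det := by simp [hdet]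
  have key : ∀ w, mink (lcross (A *ᵥ a) (A *ᵥ b) - A *ᵥ lcross a b) w = 0 := fun w => by
    obtain ⟨z, rfl⟩ : ∃ z, A *ᵥ z = w := ⟨A⁻¹ *ᵥ w, by
      rw [Matrix.mulVec_mulVec, Matrix.mul_nonsing_inv _ hunit, Matrix.one_mulVec]⟩
    have h1 : mink (A *ᵥ lcross a b) (A *ᵥ z) = mink (lcross (A *ᵥ a) (A *ᵥ b)) (A *ᵥ z) := by
      rw [hA, mink_lcross, mink_lcross, det_mulVec, hdet, one_mul]
    rw [sub_eq_add_neg, ← neg_one_smul ℝ, mink_add_left, mink_smul_left, h1]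
    ring
  refine sub_eq_zero.1 (funext fun i => ?_)
  have := key (Pi.single i 1)
  rw [Pi.zero_apply]
  fin_cases i <;> simp [mink] at this ⊢ <;> linarith

variable {D : Set (ℝ × ℝ)} {x y : ℝ × ℝ → R31} {b : R31} (hD : IsOpen D)
  (hx : ContDiffOn ℝ ∞ x D) (hy : ∀ p ∈ D, y p = A *ᵥ x p + b)
include hD hx hy

theorem coeffs_motion {p : ℝ × ℝ} (hp : p ∈ D) :
    coeffE y p = coeffE x p ∧ coeffF y p = coeffF x p ∧ coeffG y p = coeffG x p ∧
      coeffL y p = coeffL x p ∧ coeffM y p = coeffM x p ∧ coeffN y p = coeffN x p := by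
  have hu := du_mulVec hD A hx hy
  have hv := dv_mulVec hD A hx hy
  have huu := du_mulVec hD A (b := 0) (hx.du hD) (by simpa using hu) p hp
  have huv := dv_mulVec hD A (b := 0) (hx.du hD) (by simpa using hu) p hp
  have hvv := dv_mulVec hD A (b := 0) (hx.dv hD) (by simpa using hv) p hp
  have hn : normal y p = A *ᵥ normal x p := by
    rw [normal, normal, hu p hp, hv p hp, lcross_mulVec hA hdet, hA, Matrix.mulVec_smul]
  simp only [coeffE, coeffF, coeffG, coeffL, coeffM, coeffN, hu p hp, hv p hp, huu, huv, hvv, hn,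
    hA, and_self]

theorem meanH_motion {p : ℝ × ℝ} (hp : p ∈ D) : meanH y p = meanH x p := by
  obtain ⟨hE, hF, hG, hL, hM, hN⟩ := coeffs_motion hA hdet hD hx hy hp
  rw [meanH, meanH, hE, hF, hG, hL, hM, hN]

theorem gaussK_motion {p : ℝ × ℝ} (hp : p ∈ D) : gaussK y p = gaussK x p := by
  obtain ⟨hE, hF, hG, hL, hM, hN⟩ := coeffs_motion hA hdet hD hx hy hp
  rw [gaussK, gaussK, hE, hF, hG, hL, hM, hN]

omit hD hx in
theorem IsCanonical.motion {p₀ : ℝ × ℝ} {ε₁ ε₂ : ℝ} (h : IsCanonical D x p₀ ε₁ ε₂) :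
    IsCanonical D y p₀ ε₁ ε₂ := by
  have hc := fun p (hp : p ∈ D) => coeffs_motion hA hdet h.isOpen h.smooth hy hp
  exact
  { isOpen := h.isOpen
    smooth := by
      have h1 : ContDiffOn ℝ ∞ (fun p => A *ᵥ x p + b) D :=
        ((A.mulVecLin.toContinuousLinearMap).contDiff.comp_contDiffOn h.smooth).add
          contDiffOn_const
      exact h1.congr hy
    immersion := fun p hp => by
      have h1 : ∀ k, fderiv ℝ y p k = A *ᵥ fderiv ℝ x p k := fun k => by
        rw [fderiv_eq_gradMap, fderiv_eq_gradMap, du_mulVec h.isOpen A h.smooth hy p hp,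
          dv_mulVec h.isOpen A h.smooth hy p hp, gradMap_apply, gradMap_apply, Matrix.mulVec_add,
          Matrix.mulVec_smul, Matrix.mulVec_smul]
      have h2 : Function.Injective (A.mulVec) :=
        Matrix.mulVec_injective_of_isUnit ((Matrix.isUnit_iff_isUnit_det A).2 (by simp [hdet]))
      intro k k' hk
      rw [h1, h1] at hk
      exact h.immersion p hp (h2 hk)
    lorentz := fun p hp => by
      obtain ⟨hE, hF, hG, -⟩ := hc p hp
      rw [hE, hF, hG]
      exact h.lorentz p hp
    general := fun p hp => by
      rw [meanH_motion hA hdet h.isOpen h.smooth hy hp,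
        gaussK_motion hA hdet h.isOpen h.smooth hy hp]
      exact h.general p hp
    mem := h.mem
    isotropicE := fun p hp => (hc p hp).1.trans (h.isotropicE p hp)
    isotropicG := fun p hp => (hc p hp).2.2.1.trans (h.isotropicG p hp)
    posF := fun p hp => (h.posF p hp).trans_eq (hc p hp).2.1.symm
    sign₁ := h.sign₁
    sign₂ := h.sign₂
    canonicalL := fun u hu => (hc _ hu).2.2.2.1.trans (h.canonicalL u hu)
    canonicalN := fun v hv => (hc _ hv).2.2.2.2.2.trans (h.canonicalN v hv) }

end Motion

theorem IsCanonical.comp_properMotion {D : Set (ℝ × ℝ)} {x : ℝ × ℝ → R31} {p₀ : ℝ × ℝ}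
    {ε₁ ε₂ : ℝ} (h : IsCanonical D x p₀ ε₁ ε₂) {g : R31 → R31} (hg : IsProperMotion g) :
    IsCanonical D (g ∘ x) p₀ ε₁ ε₂ ∧
      EqOn (coeffF (g ∘ x)) (coeffF x) D ∧ EqOn (meanH (g ∘ x)) (meanH x) D := by
  obtain ⟨A, b, hA, hdet, hg⟩ := hg
  have hy : ∀ p ∈ D, (g ∘ x) p = A *ᵥ x p + b := fun p _ => hg (x p)
  exact ⟨h.motion hA hdet hy,
    fun p hp => (coeffs_motion hA hdet h.isOpen h.smooth hy hp).2.1,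
    fun p hp => meanH_motion hA hdet h.isOpen h.smooth hy hp⟩

/-- Two surfaces in canonical isotropic coordinates on a rectangle that generate the same solution
of the natural equation differ by a proper motion. -/
theorem IsCanonical.exists_properMotion {R : Set (ℝ × ℝ)} (hR : IsOpenRectangle R)
    {x y : ℝ × ℝ → R31} {p₀ : ℝ × ℝ} {ε₁ ε₂ : ℝ} (hx : IsCanonical R x p₀ ε₁ ε₂)
    (hy : IsCanonical R y p₀ ε₁ ε₂) (hF : EqOn (coeffF x) (coeffF y) R)
    (hH : EqOn (meanH x) (meanH y) R) :
    ∃ g : R31 → R31, IsProperMotion g ∧ EqOn y (g ∘ x) R := by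
  have hconv : Convex ℝ R := by
    obtain ⟨a, b, c, d, rfl⟩ := hR
    exact (convex_Ioo a b).prod (convex_Ioo c d)
  have hc : IsPreconnected R := hconv.isPreconnected
  have hp₀ := hx.mem
  have hseg : ∀ p ∈ R, (∀ s ∈ uIcc p₀.2 p.2, (p.1, s) ∈ R) ∧
      ∀ s ∈ uIcc p₀.1 p.1, (s, p.2) ∈ R := by
    obtain ⟨a, b, c, d, rfl⟩ := hR
    exact fun p hp => ⟨fun s hs => ⟨hp.1, ordConnected_Ioo.uIcc_subset hp₀.2 hp.2 hs⟩,
      fun s hs => ⟨ordConnected_Ioo.uIcc_subset hp₀.1 hp.1 hs, hp.2⟩⟩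
  have hL : EqOn (coeffL x) (coeffL y) R := fun p hp => by
    have hs := (hseg p hp).1
    have h1 : coeffL x p = _ := hx.coeffL_eq_integral hs
    have h2 : coeffL y p = _ := hy.coeffL_eq_integral hs
    rw [h1, h2]
    congr 1
    refine intervalIntegral.integral_congr fun s hs' => ?_
    rw [hF (hs s hs'), du_congr hx.isOpen hH (hs s hs')]
  have hN : EqOn (coeffN x) (coeffN y) R := fun p hp => by
    have hs := (hseg p hp).2
    have h1 : coeffN x p = _ := hx.coeffN_eq_integral hs
    have h2 : coeffN y p = _ := hy.coeffN_eq_integral hs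
    rw [h1, h2]
    congr 1
    refine intervalIntegral.integral_congr fun s hs' => ?_
    rw [hF (hs s hs'), dv_congr hx.isOpen hH (hs s hs')]
  have hM : EqOn (coeffM x) (coeffM y) R := fun p hp => by
    rw [hx.coeffM_eq hp, hy.coeffM_eq hp, hF hp, hH hp]
  have hfx := hx.frameEqs
  have hfy := hy.frameEqs.congr hx.isOpen hF.symm hL.symm hM.symm hN.symm
  have hFd := fun p hp => hx.smoothF.differentiableAt_of_isOpen hx.isOpen (p := p) hp
  -- `J` is the diagonal of the scalar product. `C p` is the matrix taking the frame of `x` at `p`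
  -- to that of `y`; its entries are pairings of coordinate solutions, up to the sign `J j`.
  let J : Fin 3 → ℝ := ![-1, 1, 1]
  let C : ℝ × ℝ → Matrix (Fin 3) (Fin 3) ℝ := fun p => Matrix.of fun i j =>
    ((du y p i * dv x p j + dv y p i * du x p j) / coeffF x p + normal y p i * normal x p j) * J j
  have hCconst : ∀ p ∈ R, C p = C p₀ := fun p hp => by
    ext i j
    simp only [C, Matrix.of_apply]
    congr 1
    exact (hfx.coord j).pairing_eq hx.isOpen hc hFd hx.posF (hfy.coord i) hp hp₀
  have hCapply : ∀ p ∈ R, ∀ w : R31, C p *ᵥ w = (mink w (dv x p) / coeffF x p) • du y p +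
      (mink w (du x p) / coeffF x p) • dv y p + mink w (normal x p) • normal y p := by
    intro p hp w
    ext i
    simp [C, J, Matrix.mulVec, dotProduct, Fin.sum_univ_three, mink]
    ring
  have hCu : ∀ p ∈ R, C p₀ *ᵥ du x p = du y p := fun p hp => by
    have hf := hx.frame hp
    rw [← hCconst p hp, hCapply p hp, hf.ab, hf.aa, hf.al, div_self hf.pos.ne']
    simp
  have hCv : ∀ p ∈ R, C p₀ *ᵥ dv x p = dv y p := fun p hp => by
    have hf := hx.frame hp
    rw [← hCconst p hp, hCapply p hp, hf.ba, hf.bb, hf.bl, div_self hf.pos.ne']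
    simp
  have hCl : C p₀ *ᵥ normal x p₀ = normal y p₀ := by
    have hf := hx.frame hp₀
    rw [hCapply p₀ hp₀, hf.la, hf.lb, hf.ll]
    simp
  have hfx₀ := hx.frame hp₀
  have hfy₀ := hy.frame hp₀
  rw [← hF hp₀] at hfy₀
  have hF₀ := hfx₀.pos.ne'
  -- The two frames have the same Gram matrix at `p₀`, hence `C p₀` is an isometry; they also have
  -- the same determinant `F`, hence `C p₀` has determinant `1`.
  have hCmink : ∀ w z, mink (C p₀ *ᵥ w) (C p₀ *ᵥ z) = mink w z := fun w z => by
    rw [hCapply p₀ hp₀, hCapply p₀ hp₀, hfx₀.mink_eq w z]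
    simp only [mink_add_left, mink_add_right, mink_smul_left, mink_smul_right, hfy₀.aa, hfy₀.ab,
      hfy₀.bb, hfy₀.ba, hfy₀.la, hfy₀.lb, hfy₀.al, hfy₀.bl, hfy₀.ll]
    field_simp
    ring
  have hCdet : (C p₀).det = 1 := by
    have h1 := det_mulVec (C p₀) (du x p₀) (dv x p₀) (normal x p₀)
    rw [hCu p₀ hp₀, hCv p₀ hp₀, hCl, hfx₀.det_eq, hfy₀.det_eq] at h1
    exact mul_right_cancel₀ hF₀ (by rw [← h1, one_mul])
  refine ⟨fun w => C p₀ *ᵥ w + (y p₀ - C p₀ *ᵥ x p₀), ⟨C p₀, _, hCmink, hCdet, fun _ => rfl⟩,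
    fun p hp => ?_⟩
  have hconst := eq_of_hasFDerivAt_zero hx.isOpen hc (f := fun q => y q - (C p₀ *ᵥ x q + 0))
    (fun q hq => ?_) hp hp₀
  · simp only [add_zero] at hconst
    simp only [Function.comp_apply, ← hconst]
    abel
  · refine ((hy.smooth.differentiableAt_of_isOpen hx.isOpen hq).hasFDerivAt_gradMap.sub
      (hasFDerivAt_mulVec (C p₀) (hx.smooth.differentiableAt_of_isOpen hx.isOpen hq)
        0)).congr_fderiv ?_
    rw [hCu q hq, hCv q hq, sub_self]

end LorentzSurface

/-! ### Extension of the data, the system for position and frame, and recognition of isotropic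
frames. -/

namespace LorentzSurface

open Filter Topology

/-- A smooth function near a point agrees near that point with a globally smooth one, obtained by
interpolation with a constant. -/
theorem exists_contDiff_extension {f : ℝ × ℝ → ℝ} {U : Set (ℝ × ℝ)} {p₀ : ℝ × ℝ} (hU : IsOpen U)
    (hp₀ : p₀ ∈ U) (hf : ContDiffOn ℝ ∞ f U) (c : ℝ) :
    ∃ g : ℝ × ℝ → ℝ, ContDiff ℝ ∞ g ∧ g =ᶠ[𝓝 p₀] f ∧
      ((∀ p ∈ U, 0 < f p) → 0 < c → ∀ p, 0 < g p) := by
  obtain ⟨r, hr, hrU⟩ := Metric.nhds_basis_closedBall.mem_iff.1 (hU.mem_nhds hp₀)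
  let χ : ContDiffBump p₀ := ⟨r / 2, r, by positivity, by linarith⟩
  have hsupp : ∀ p ∉ U, p ∉ tsupport χ := fun p hp hpt => hp (hrU (by rwa [χ.tsupport_eq] at hpt))
  refine ⟨fun p => c + χ p * (f p - c), contDiff_iff_contDiffAt.2 fun p => ?_, ?_, ?_⟩
  · by_cases hp : p ∈ U
    · exact contDiffAt_const.add (χ.contDiffAt.mul
        ((hf.contDiffAt (hU.mem_nhds hp)).sub contDiffAt_const))
    · refine (contDiffAt_const (c := c)).congr_of_eventuallyEq ?_
      filter_upwards [notMem_tsupport_iff_eventuallyEq.1 (hsupp p hp)] with q hq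
      simp [hq]
  · filter_upwards [χ.eventuallyEq_one] with q hq
    simp [hq]
  · intro hpos hc p
    by_cases hp : p ∈ U
    · have h0 := χ.nonneg (x := p)
      have h1 := χ.le_one (x := p)
      have h2 := hpos p hp
      dsimp only
      rcases h0.eq_or_lt with h0 | h0
      · simpa [← h0] using hc
      · nlinarith [mul_pos h0 h2, mul_nonneg (sub_nonneg.2 h1) hc.le]
    · have : χ p = 0 := image_eq_zero_of_notMem_tsupport (hsupp p hp)
      simpa [this] using hc

/-- The continuous linear endomorphism of `ℝⁿ` given by a matrix. -/
noncomputable def matCLM (n : ℕ) :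
    (Fin n → Fin n → ℝ) →L[ℝ] ((Fin n → ℝ) →L[ℝ] (Fin n → ℝ)) :=
  LinearMap.toContinuousLinearMap
    ((LinearMap.toContinuousLinearMap (𝕜 := ℝ) (E := Fin n → ℝ) (F' := Fin n → ℝ)).toLinearMap ∘ₗ
      (Matrix.toLin' (R := ℝ) (m := Fin n) (n := Fin n)).toLinearMap ∘ₗ
      (Matrix.ofLinearEquiv ℝ).toLinearMap)

@[simp]
theorem matCLM_apply (n : ℕ) (M : Fin n → Fin n → ℝ) (w : Fin n → ℝ) :
    matCLM n M w = Matrix.of M *ᵥ w := by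
  simp [matCLM]

theorem hasFDerivAt_matCLM {n : ℕ} {M : ℝ × ℝ → Fin n → Fin n → ℝ} {p : ℝ × ℝ}
    (hM : ∀ i j, DifferentiableAt ℝ (fun q => M q i j) p) :
    HasFDerivAt (fun q => matCLM n (M q))
      (gradMap (matCLM n fun i j => du (fun q => M q i j) p)
        (matCLM n fun i j => dv (fun q => M q i j) p)) p := by
  have h1 : HasFDerivAt M (gradMap (fun i j => du (fun q => M q i j) p)
      (fun i j => dv (fun q => M q i j) p)) p := by
    refine hasFDerivAt_pi'.2 fun i => hasFDerivAt_pi'.2 fun j => ?_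
    refine (hM i j).hasFDerivAt_gradMap.congr_fderiv ?_
    ext <;> simp
  refine ((matCLM n).hasFDerivAt.comp p h1).congr_fderiv ?_
  ext : 2 <;> simp

/-- Local solvability of the linear system for the position and the moving frame. -/
theorem exists_frame_solution {P Q L M N H K₁ K₂ : ℝ × ℝ → ℝ} (hP : ContDiff ℝ ∞ P)
    (hQ : ContDiff ℝ ∞ Q) (hL : ContDiff ℝ ∞ L) (hM : ContDiff ℝ ∞ M) (hN : ContDiff ℝ ∞ N)
    (hH : ContDiff ℝ ∞ H) (hK₁ : ContDiff ℝ ∞ K₁) (hK₂ : ContDiff ℝ ∞ K₂) {p₀ : ℝ × ℝ}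
    {U : Set (ℝ × ℝ)} (hU : U ∈ 𝓝 p₀)
    (cP : ∀ p ∈ U, dv P p = L p * K₂ p - M p * H p)
    (cQ : ∀ p ∈ U, du Q p = N p * K₁ p - M p * H p)
    (cL : ∀ p ∈ U, dv L p + P p * M p = du M p)
    (cN : ∀ p ∈ U, du N p + Q p * M p = dv M p)
    (cK₁ : ∀ p ∈ U, dv K₁ p + K₁ p * Q p = du H p)
    (cK₂ : ∀ p ∈ U, du K₂ p + K₂ p * P p = dv H p)
    (c₁ : ∀ p ∈ U, M p * K₁ p = L p * H p) (c₂ : ∀ p ∈ U, M p * K₂ p = N p * H p)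
    (c₃ : ∀ p ∈ U, K₁ p * N p = K₂ p * L p) :
    ∃ r > 0, square p₀ r ⊆ U ∧ ∀ w₀ : Fin 4 → ℝ, ∃ x a b l : ℝ × ℝ → ℝ,
      (a p₀ = w₀ 1 ∧ b p₀ = w₀ 2 ∧ l p₀ = w₀ 3) ∧
      ContDiffOn ℝ ∞ x (interior (square p₀ r)) ∧
      ∀ p ∈ interior (square p₀ r), HasFDerivAt x (gradMap (a p) (b p)) p ∧
        HasFDerivAt a (gradMap (P p * a p + L p * l p) (M p * l p)) p ∧
        HasFDerivAt b (gradMap (M p * l p) (Q p * b p + N p * l p)) p ∧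
        HasFDerivAt l (gradMap (-(H p * a p) - K₁ p * b p) (-(K₂ p * a p) - H p * b p)) p := by
  -- The unknown is one coordinate of `(x, a, b, l)`. The first rows encode `x_u = a` and `x_v = b`,
  -- so position and frame are found together.
  let A : ℝ × ℝ → Fin 4 → Fin 4 → ℝ := fun p =>
    ![![0, 1, 0, 0], ![0, P p, 0, L p], ![0, 0, 0, M p], ![0, -H p, -K₁ p, 0]]
  let B : ℝ × ℝ → Fin 4 → Fin 4 → ℝ := fun p =>
    ![![0, 0, 1, 0], ![0, 0, 0, M p], ![0, 0, Q p, N p], ![0, -K₂ p, -H p, 0]]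
  have hA' : ∀ i j, ContDiff ℝ ∞ fun p => A p i j := fun i j => by
    fin_cases i <;> fin_cases j <;> first
      | exact contDiff_const | exact hP | exact hL | exact hM | exact hH.neg | exact hK₁.neg
  have hB' : ∀ i j, ContDiff ℝ ∞ fun p => B p i j := fun i j => by
    fin_cases i <;> fin_cases j <;> first
      | exact contDiff_const | exact hQ | exact hN | exact hM | exact hH.neg | exact hK₂.neg
  have hA : ContDiff ℝ ∞ fun p => matCLM 4 (A p) :=
    (matCLM 4).contDiff.comp (contDiff_pi.2 fun i => contDiff_pi.2 fun j => hA' i j)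
  have hB : ContDiff ℝ ∞ fun p => matCLM 4 (B p) :=
    (matCLM 4).contDiff.comp (contDiff_pi.2 fun i => contDiff_pi.2 fun j => hB' i j)
  obtain ⟨r, hr, hrU, hsol⟩ := exists_solution_linear_system (hA.of_le (by exact_mod_cast le_top))
    (hB.of_le (by exact_mod_cast le_top)) hU fun p hp => by
      have cP := cP p hp
      have cQ := cQ p hp
      have cL := cL p hp
      have cN := cN p hp
      have cK₁ := cK₁ p hp
      have cK₂ := cK₂ p hp
      have c₁ := c₁ p hp
      have c₂ := c₂ p hp
      have c₃ := c₃ p hp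
      have hd0 : ∀ c : ℝ, dv (fun _ : ℝ × ℝ => c) p = 0 ∧ du (fun _ : ℝ × ℝ => c) p = 0 :=
        fun c => by simp [du, dv]
      have hneg : ∀ f : ℝ × ℝ → ℝ, dv (fun q => -f q) p = -dv f p ∧
          du (fun q => -f q) p = -du f p := fun f => by simp [du, dv, fderiv_fun_neg]
      rw [dv_eq_of_hasFDerivAt (hasFDerivAt_matCLM fun i j =>
          (hA' i j).differentiable (by simp) p),
        du_eq_of_hasFDerivAt (hasFDerivAt_matCLM fun i j =>
          (hB' i j).differentiable (by simp) p)]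
      have key : (Matrix.of fun i j => dv (fun q => A q i j) p) + Matrix.of (A p) * Matrix.of (B p) =
          (Matrix.of fun i j => du (fun q => B q i j) p) + Matrix.of (B p) * Matrix.of (A p) := by
        ext i j
        fin_cases i <;> fin_cases j <;>
          simp [A, B, hd0, hneg] <;> linarith
      refine ContinuousLinearMap.ext fun w => ?_
      have := congrArg (fun X => X *ᵥ w) key
      simpa [Matrix.add_mulVec, Matrix.mulVec_mulVec] using this
  refine ⟨r, hr, hrU, fun w₀ => ?_⟩
  obtain ⟨w, hw₀, hw⟩ := hsol w₀
  have hws := contDiffOn_of_linear_system hA hB isOpen_interior hw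
  refine ⟨fun p => w p 0, fun p => w p 1, fun p => w p 2, fun p => w p 3, by simp [hw₀],
    contDiffOn_pi.1 hws 0, fun p hp => ?_⟩
  have hc := hasFDerivAt_coord (hw p hp)
  refine ⟨(hc 0).congr_fderiv ?_, (hc 1).congr_fderiv ?_, (hc 2).congr_fderiv ?_,
    (hc 3).congr_fderiv ?_⟩ <;> congr 1 <;>
  simp [A, B, Matrix.mulVec, dotProduct, Fin.sum_univ_four] <;> ring

theorem lcross_comm_cyclic (a b c : R31) : mink (lcross b c) a = mink (lcross a b) c := by
  simp [mink, lcross]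
  ring

/-- A triple of vectors whose dual quadratic form is the scalar product is an isotropic frame. -/
theorem isIsotropicFrame_of_dual {F : ℝ} {a b l : R31} (hF : 0 < F)
    (hdual : ∀ i j, (a i * b j + b i * a j) / F + l i * l j = !![-1, 0, 0; 0, 1, 0; 0, 0, 1] i j)
    (hdet : mink (lcross a b) l = F) : IsIsotropicFrame F a b l := by
  have hF' := hF.ne'
  -- Contracting the dual relation with the covector `⟨w, ·⟩` gives the expansion of `w` in the
  -- triple.
  have hex : ∀ w : R31, w = (mink w b / F) • a + (mink w a / F) • b + mink w l • l := fun w => by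
    have h := fun i => congrArg₂ (· + ·) (congrArg₂ (· + ·) (congrArg (-w 0 * ·) (hdual i 0))
      (congrArg (w 1 * ·) (hdual i 1))) (congrArg (w 2 * ·) (hdual i 2))
    ext i
    have hi := h i
    have : w i = -w 0 * !![-1, 0, 0; 0, 1, 0; 0, 0, (1 : ℝ)] i 0 +
        w 1 * !![-1, 0, 0; 0, 1, 0; 0, 0, (1 : ℝ)] i 1 +
        w 2 * !![-1, 0, 0; 0, 1, 0; 0, 0, (1 : ℝ)] i 2 := by
      fin_cases i <;> simp
    rw [this, ← hi]
    simp [mink]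
    ring
  -- Pairing the expansion with `b × l` isolates one coefficient, so `b × l` represents `⟨·, b⟩`.
  -- Cyclically, `l × a` represents `⟨·, a⟩`; all products of the triple then become determinants.
  have h1 : ∀ w, mink w b = mink (lcross b l) w := fun w => by
    conv_rhs => rw [hex w]
    have e1 : mink (lcross b l) a = F := by rw [lcross_comm_cyclic, hdet]
    simp only [mink_add_right, mink_smul_right, e1, mink_lcross_left, mink_lcross_right]
    field_simp
    ring
  have h2 : ∀ w, mink w a = mink (lcross l a) w := fun w => by
    conv_rhs => rw [hex w]
    have e1 : mink (lcross l a) b = F := by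
      rw [lcross_comm_cyclic, lcross_comm_cyclic, hdet]
    simp only [mink_add_right, mink_smul_right, e1, mink_lcross_left, mink_lcross_right]
    field_simp
    ring
  have h3 : ∀ w, mink w l * F = mink (lcross a b) w := fun w => by
    conv_rhs => rw [hex w]
    simp only [mink_add_right, mink_smul_right, hdet, mink_lcross_left, mink_lcross_right]
    ring
  have haa : mink a a = 0 := by rw [h2, mink_lcross_right]
  have hbb : mink b b = 0 := by rw [h1, mink_lcross_left]
  have hab : mink a b = F := by rw [h1, lcross_comm_cyclic, hdet]
  refine ⟨hF, haa, hbb, hab, ?_⟩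
  have h4 := mink_lcross_self_smul a b l
  have hla : mink l a = 0 := by rw [h2, mink_lcross_left]
  have hlb : mink l b = 0 := by rw [h1, mink_lcross_right]
  rw [mink_lcross_self, haa, hab, hla, hlb, mink_comm l, hdet] at h4
  have h5 : F • (F • l) = F • lcross a b := by
    simpa [smul_smul, sq] using h4
  exact (smul_right_injective R31 hF' h5).symm

end LorentzSurface

/-! ### Existence of the surface. -/

namespace LorentzSurface

open Filter Topology

theorem du_div {f g : ℝ × ℝ → ℝ} {p : ℝ × ℝ} (hf : DifferentiableAt ℝ f p)
    (hg : DifferentiableAt ℝ g p) (h0 : g p ≠ 0) :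
    du (fun q => f q / g q) p = du f p / g p - f p * du g p / g p ^ 2 := by
  rw [du, (hasFDerivAt_div hf.hasFDerivAt hg.hasFDerivAt h0).fderiv]
  simp [du]
  ring

theorem dv_div {f g : ℝ × ℝ → ℝ} {p : ℝ × ℝ} (hf : DifferentiableAt ℝ f p)
    (hg : DifferentiableAt ℝ g p) (h0 : g p ≠ 0) :
    dv (fun q => f q / g q) p = dv f p / g p - f p * dv g p / g p ^ 2 := by
  rw [dv, (hasFDerivAt_div hf.hasFDerivAt hg.hasFDerivAt h0).fderiv]
  simp [dv]
  ring

/-- The Gauss and Codazzi equations suffice for a local surface with given coefficients. -/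
theorem exists_surface {F L N H : ℝ × ℝ → ℝ} (hF : ContDiff ℝ ∞ F) (hL : ContDiff ℝ ∞ L)
    (hN : ContDiff ℝ ∞ N) (hH : ContDiff ℝ ∞ H) (hF0 : ∀ p, 0 < F p) {p₀ : ℝ × ℝ}
    {U : Set (ℝ × ℝ)} (hU : U ∈ 𝓝 p₀) (cL : ∀ p ∈ U, dv L p = F p * du H p)
    (cN : ∀ p ∈ U, du N p = F p * dv H p)
    (cG : ∀ p ∈ U, (F p * dv (du F) p - du F p * dv F p) / F p =
      L p * N p - F p ^ 2 * H p ^ 2) :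
    ∃ r > 0, square p₀ r ⊆ U ∧ ∃ x : ℝ × ℝ → R31,
      ContDiffOn ℝ ∞ x (interior (square p₀ r)) ∧ ∀ p ∈ interior (square p₀ r),
        coeffE x p = 0 ∧ coeffG x p = 0 ∧ coeffF x p = F p ∧ coeffL x p = L p ∧
          coeffM x p = F p * H p ∧ coeffN x p = N p := by
  have hFn : ∀ p, F p ≠ 0 := fun p => (hF0 p).ne'
  have hFd := fun p => hF.differentiable (by simp) p
  have hHd := fun p => hH.differentiable (by simp) p
  have hFud := fun p => hF.du.differentiable (by simp) p
  have hFvd := fun p => hF.dv.differentiable (by simp) p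
  have hLd := fun p => hL.differentiable (by simp) p
  have hNd := fun p => hN.differentiable (by simp) p
  -- Of the nine compatibility conditions the first two amount to the Gauss equation, the next four
  -- to the Codazzi equations, and the last three are identities.
  obtain ⟨r, hr, hrU, hsol⟩ := exists_frame_solution (P := fun p => du F p / F p)
    (Q := fun p => dv F p / F p) (M := fun p => F p * H p) (K₁ := fun p => L p / F p)
    (K₂ := fun p => N p / F p) (hF.du.div hF hFn) (hF.dv.div hF hFn) hL (hF.mul hH) hN hH
    (hL.div hF hFn) (hN.div hF hFn) hU
    (fun p hp => by
      have := cG p hp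
      have h0 := hFn p
      rw [dv_div (hFud p) (hFd p) h0]
      field_simp at this ⊢
      linarith)
    (fun p hp => by
      have := cG p hp
      have h0 := hFn p
      rw [du_div (hFvd p) (hFd p) h0, du_dv_comm hF.contDiffAt]
      field_simp at this ⊢
      linarith)
    (fun p hp => by
      have h0 := hFn p
      rw [cL p hp, du_mul (hFd p) (hHd p)]
      field_simp)
    (fun p hp => by
      have h0 := hFn p
      rw [cN p hp, dv_mul (hFd p) (hHd p)]
      field_simp)
    (fun p hp => by
      have h0 := hFn p
      rw [dv_div (hLd p) (hFd p) h0, cL p hp]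
      field_simp
      ring)
    (fun p hp => by
      have h0 := hFn p
      rw [du_div (hNd p) (hFd p) h0, cN p hp]
      field_simp
      ring)
    (fun p _ => by
      have h0 := hFn p
      field_simp)
    (fun p _ => by
      have h0 := hFn p
      field_simp)
    (fun p _ => by ring)
  refine ⟨r, hr, hrU, ?_⟩
  set Q := interior (square p₀ r) with hQ
  have hQo : IsOpen Q := isOpen_interior
  have hp₀ : p₀ ∈ Q := mem_interior_iff_mem_nhds.2 (square_mem_nhds p₀ hr)
  have hQc : IsPreconnected Q :=
    (((convex_Icc _ _).prod (convex_Icc _ _)).interior).isPreconnected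
  -- An explicit isotropic frame: `⟨a₀, b₀⟩ = F p₀` and `a₀ × b₀ = F p₀ • l₀`.
  let a₀ : R31 := ![1, 1, 0]
  let b₀ : R31 := ![-(F p₀ / 2), F p₀ / 2, 0]
  let l₀ : R31 := ![0, 0, 1]
  -- The three coordinates are solved separately, all on the same square because `r` does not depend
  -- on the initial value.
  choose x' a' b' l' hinit hsmooth hder using fun i => hsol ![0, a₀ i, b₀ i, l₀ i]
  let x : ℝ × ℝ → R31 := fun p i => x' i p
  let a : ℝ × ℝ → R31 := fun p i => a' i p
  let b : ℝ × ℝ → R31 := fun p i => b' i p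
  let l : ℝ × ℝ → R31 := fun p i => l' i p
  have ha₀ : a p₀ = a₀ := funext fun i => by simpa using (hinit i).1
  have hb₀ : b p₀ = b₀ := funext fun i => by simpa using (hinit i).2.1
  have hl₀ : l p₀ = l₀ := funext fun i => by simpa using (hinit i).2.2
  have hx : ∀ p ∈ Q, HasFDerivAt x (gradMap (a p) (b p)) p := fun p hp =>
    hasFDerivAt_pi'.2 fun i => (hder i p hp).1.congr_fderiv (by ext <;> simp [a, b])
  have hfr : FrameEqs Q F L (fun p => F p * H p) N a b l :=
    { da := fun p hp => hasFDerivAt_pi'.2 fun i => (hder i p hp).2.1.congr_fderiv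
        (by ext <;> simp [a, l])
      db := fun p hp => hasFDerivAt_pi'.2 fun i => (hder i p hp).2.2.1.congr_fderiv
        (by ext <;> simp [b, l])
      dl := fun p hp => hasFDerivAt_pi'.2 fun i => (hder i p hp).2.2.2.congr_fderiv
        (by ext <;> simp [a, b, mul_div_cancel_left₀ _ (hFn p)]) }
  have hiso : ∀ p ∈ Q, IsIsotropicFrame (F p) (a p) (b p) (l p) := fun p hp => by
    have h0 := hFn p₀
    refine isIsotropicFrame_of_dual (hF0 p) (fun i j => ?_) ?_
    · rw [(hfr.coord j).pairing_eq hQo hQc (fun q _ => hFd q) (fun q _ => hF0 q) (hfr.coord i)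
        hp hp₀, ha₀, hb₀, hl₀]
      fin_cases i <;> fin_cases j <;> simp [a₀, b₀, l₀, h0]
      rw [← neg_add, add_halves, neg_div, div_self h0]
    · have h1 := hfr.det_eq hQo hQc (fun q _ => hFd q) (fun q _ => hF0 q) hp hp₀
      have h2 : mink (lcross (a p₀) (b p₀)) (l p₀) / F p₀ = 1 := by
        rw [ha₀, hb₀, hl₀]
        simp [a₀, b₀, l₀, mink, lcross, h0]
      rw [h2, div_eq_one_iff_eq (hFn p)] at h1
      exact h1
  have hu : EqOn (du x) a Q := fun p hp => du_eq_of_hasFDerivAt (hx p hp)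
  have hv : EqOn (dv x) b Q := fun p hp => dv_eq_of_hasFDerivAt (hx p hp)
  refine ⟨x, contDiffOn_pi.2 hsmooth, fun p hp => ?_⟩
  have hi := hiso p hp
  have hE : coeffE x p = 0 := by rw [coeffE, hu hp, hi.aa]
  have hG : coeffG x p = 0 := by rw [coeffG, hv hp, hi.bb]
  have hFp : coeffF x p = F p := by rw [coeffF, hu hp, hv hp, hi.ab]
  have hn : normal x p = l p := by
    rw [normal_eq_of_isotropic hE (hFp ▸ hF0 p), hFp, hu hp, hv hp, ← hi.normal_eq]
  refine ⟨hE, hG, hFp, ?_, ?_, ?_⟩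
  · rw [coeffL, hn, du_congr hQo hu hp, du_eq_of_hasFDerivAt (hfr.da p hp)]
    simp [hi.al, hi.ll]
  · rw [coeffM, hn, dv_congr hQo hu hp, dv_eq_of_hasFDerivAt (hfr.da p hp)]
    simp [hi.ll]
  · rw [coeffN, hn, dv_congr hQo hv hp, dv_eq_of_hasFDerivAt (hfr.db p hp)]
    simp [hi.bl, hi.ll]

theorem sign_eq_of_mul_pos {s t : ℝ} (h : 0 < s * t) : SignType.sign s = SignType.sign t := by
  rcases mul_pos_iff.1 h with ⟨hs, ht⟩ | ⟨hs, ht⟩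
  · rw [sign_pos hs, sign_pos ht]
  · rw [sign_neg hs, sign_neg ht]

theorem eq_of_sign_eq {δ ε : ℝ} (hδ : δ = 1 ∨ δ = -1) (hε : ε = 1 ∨ ε = -1)
    (h : SignType.sign δ = SignType.sign ε) : δ = ε := by
  rcases hδ with rfl | rfl <;> rcases hε with rfl | rfl <;> simp at h ⊢

theorem isOpenRectangle_interior_square (p₀ : ℝ × ℝ) (r : ℝ) :
    IsOpenRectangle (interior (square p₀ r)) :=
  ⟨_, _, _, _, by rw [square, interior_prod_eq, interior_Icc, interior_Icc]⟩

theorem uIcc_prod_subset_square {p₀ p : ℝ × ℝ} {r : ℝ} (hp : p ∈ interior (square p₀ r)) :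
    (∀ s ∈ uIcc p₀.2 p.2, (p.1, s) ∈ interior (square p₀ r)) ∧
      ∀ s ∈ uIcc p₀.1 p.1, (s, p.2) ∈ interior (square p₀ r) := by
  rw [square, interior_prod_eq, interior_Icc, interior_Icc] at hp ⊢
  have h1 := hp.1.1.trans hp.1.2
  have h2 := hp.2.1.trans hp.2.2
  refine ⟨fun s hs => ⟨hp.1, ordConnected_Ioo.uIcc_subset ?_ hp.2 hs⟩,
    fun s hs => ⟨ordConnected_Ioo.uIcc_subset ?_ hp.1 hs, hp.2⟩⟩ <;>
  constructor <;> linarith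

/-- Every solution of the natural equation is locally generated by a surface. -/
theorem IsNaturalSolution.exists_realizes {U : Set (ℝ × ℝ)} {p₀ : ℝ × ℝ} {ε₁ ε₂ : ℝ}
    {F H : ℝ × ℝ → ℝ} (h : IsNaturalSolution U p₀ ε₁ ε₂ F H) (hε₁ : ε₁ = 1 ∨ ε₁ = -1)
    (hε₂ : ε₂ = 1 ∨ ε₂ = -1) (hU : IsOpen U) (hp₀ : p₀ ∈ U) :
    ∃ R : Set (ℝ × ℝ), IsOpenRectangle R ∧ p₀ ∈ R ∧ R ⊆ U ∧
      ∃ x : ℝ × ℝ → R31, Realizes R x p₀ ε₁ ε₂ F H := by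
  -- Global extensions make the primitives and the coefficients of the system smooth on the whole
  -- plane; the natural equation is used only where they agree with `F` and `H`.
  obtain ⟨F', hF', hFF', hFpos⟩ := exists_contDiff_extension hU hp₀ h.smoothF (F p₀)
  obtain ⟨H', hH', hHH', -⟩ := exists_contDiff_extension hU hp₀ h.smoothH 0
  have hF0 : ∀ p, 0 < F' p := hFpos h.posF (h.posF p₀ hp₀)
  obtain ⟨ρ, hρ, hρU⟩ := exists_square_subset (p₀ := p₀)
    (U := {p | F' p = F p ∧ H' p = H p ∧ p ∈ U})
    (hFF'.and (hHH'.and (hU.mem_nhds hp₀)))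
  have hS : IsOpen (interior (square p₀ ρ)) := isOpen_interior
  have hSsub := fun p (hp : p ∈ interior (square p₀ ρ)) => hρU (interior_subset hp)
  have hFe : EqOn F' F (interior (square p₀ ρ)) := fun p hp => (hSsub p hp).1
  have hHe : EqOn H' H (interior (square p₀ ρ)) := fun p hp => (hSsub p hp).2.1
  have hFHu : ContDiff ℝ ∞ fun p => F' p * du H' p := hF'.mul hH'.du
  have hFHv : ContDiff ℝ ∞ fun p => F' p * dv H' p := hF'.mul hH'.dv
  let L : ℝ × ℝ → ℝ := fun p => ε₁ + ∫ s in p₀.2..p.2, F' (p.1, s) * du H' (p.1, s)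
  let N : ℝ × ℝ → ℝ := fun p => ε₂ + ∫ s in p₀.1..p.1, F' (s, p.2) * dv H' (s, p.2)
  have hL : ContDiff ℝ ∞ L := contDiff_const.add (contDiff_primitive_snd hFHu p₀.2)
  have hN : ContDiff ℝ ∞ N := contDiff_const.add (contDiff_primitive_fst hFHv p₀.1)
  have hL₀ : ∀ u, L (u, p₀.2) = ε₁ := fun u => by simp [L]
  have hN₀ : ∀ v, N (p₀.1, v) = ε₂ := fun v => by simp [N]
  -- At `p₀` the products `L p * ε₁` and `N p * ε₂` equal `1`; their positivity nearby gives both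
  -- the sign conditions and general type.
  have hsq : ∀ {ε : ℝ}, ε = 1 ∨ ε = -1 → ε * ε = 1 := by
    rintro ε (rfl | rfl) <;> norm_num
  have hLpos : ∀ᶠ p in 𝓝 p₀, 0 < L p * ε₁ :=
    (hL.continuous.mul continuous_const).continuousAt.eventually_const_lt
      (by simp [L, hsq hε₁])
  have hNpos : ∀ᶠ p in 𝓝 p₀, 0 < N p * ε₂ :=
    (hN.continuous.mul continuous_const).continuousAt.eventually_const_lt
      (by simp [N, hsq hε₂])
  have hnhds : {p | p ∈ interior (square p₀ ρ) ∧ 0 < L p * ε₁ ∧ 0 < N p * ε₂} ∈ 𝓝 p₀ :=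
    inter_mem (interior_mem_nhds.2 (square_mem_nhds p₀ hρ)) (hLpos.and hNpos)
  obtain ⟨r, hr, hrsub, x, hxs, hx⟩ := exists_surface hF' hL hN hH' hF0 hnhds
    (fun p _ => dv_eq_of_hasFDerivAt ((hasFDerivAt_primitive_snd
      (hFHu.of_le (by exact_mod_cast le_top)) p₀.2 p).const_add ε₁))
    (fun p _ => du_eq_of_hasFDerivAt ((hasFDerivAt_primitive_fst
      (hFHv.of_le (by exact_mod_cast le_top)) p₀.1 p).const_add ε₂))
    (fun p hp => by
      obtain ⟨hp, -, -⟩ := hp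
      obtain ⟨hs₁, hs₂⟩ := uIcc_prod_subset_square hp
      have heq := h.equation p.1 p.2 (fun s hs => (hSsub _ (hs₁ s hs)).2.2)
        fun s hs => (hSsub _ (hs₂ s hs)).2.2
      have hLp : L p = ε₁ + ∫ s in p₀.2..p.2, F (p.1, s) * du H (p.1, s) := by
        refine congrArg (ε₁ + ·) (intervalIntegral.integral_congr fun s hs => ?_)
        rw [hFe (hs₁ s hs), du_congr hS hHe (hs₁ s hs)]
      have hNp : N p = ε₂ + ∫ s in p₀.1..p.1, F (s, p.2) * dv H (s, p.2) := by
        refine congrArg (ε₂ + ·) (intervalIntegral.integral_congr fun s hs => ?_)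
        rw [hFe (hs₂ s hs), dv_congr hS hHe (hs₂ s hs)]
      rw [hLp, hNp, hFe hp, hHe hp, du_congr hS hFe hp, dv_congr hS hFe hp,
        dv_congr hS (du_congr hS hFe) hp]
      exact heq)
  have hmem : p₀ ∈ interior (square p₀ r) :=
    mem_interior_iff_mem_nhds.2 (square_mem_nhds p₀ hr)
  have hsub := fun p (hp : p ∈ interior (square p₀ r)) => hrsub (interior_subset hp)
  have hxF : ∀ p ∈ interior (square p₀ r), 0 < coeffF x p := fun p hp => by
    rw [(hx p hp).2.2.1]
    exact hF0 p
  refine ⟨interior (square p₀ r), isOpenRectangle_interior_square p₀ r, hmem,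
    fun p hp => (hSsub p (hsub p hp).1).2.2, x, ⟨ε₁, ε₂, ?_⟩, ?_, ?_, ?_, ?_⟩
  · exact
    { isOpen := isOpen_interior
      smooth := hxs
      immersion := fun p hp => by
        obtain ⟨hE, hG, -⟩ := hx p hp
        have hi := isIsotropicFrame_of_isotropic hE hG (hxF p hp)
        rw [injective_iff_map_eq_zero]
        intro k hk
        rw [fderiv_eq_gradMap, gradMap_apply] at hk
        have h1 := congrArg (mink (dv x p)) hk
        have h2 := congrArg (mink (du x p)) hk
        rw [mink_add_right, mink_smul_right, mink_smul_right, hi.ba, hi.bb] at h1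
        rw [mink_add_right, mink_smul_right, mink_smul_right, hi.ab, hi.aa] at h2
        have h0 := hi.pos.ne'
        simp [mink, h0] at h1 h2
        exact Prod.ext h1 h2
      lorentz := fun p hp => by
        rw [(hx p hp).1, zero_mul, zero_sub]
        exact neg_lt_zero.2 (pow_pos (hxF p hp) 2)
      general := fun p hp => by
        obtain ⟨hE, hG, hFp, hLp, -, hNp⟩ := hx p hp
        rw [general_of_isotropic hE hG (hxF p hp), hLp, hNp]
        have h1 := left_ne_zero_of_mul (hsub p hp).2.1.ne'
        have h2 := left_ne_zero_of_mul (hsub p hp).2.2.ne'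
        exact div_ne_zero (mul_ne_zero h1 h2) (pow_ne_zero 2 (hxF p hp).ne')
      mem := hmem
      isotropicE := fun p hp => (hx p hp).1
      isotropicG := fun p hp => (hx p hp).2.1
      posF := hxF
      sign₁ := hε₁
      sign₂ := hε₂
      canonicalL := fun u hu => (hx _ hu).2.2.2.1.trans (hL₀ u)
      canonicalN := fun v hv => (hx _ hv).2.2.2.2.2.trans (hN₀ v) }
  · exact fun p hp => (hx p hp).2.2.1.trans (hSsub p (hsub p hp).1).1
  · intro p hp
    obtain ⟨hE, hG, hFp, -, hMp, -⟩ := hx p hp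
    rw [meanH_of_isotropic hE hG (hxF p hp), hMp, hFp, mul_div_cancel_left₀ _ (hF0 p).ne']
    exact (hSsub p (hsub p hp).1).2.1
  · exact fun p hp => by
      rw [(hx p hp).2.2.2.1]
      exact sign_eq_of_mul_pos (hsub p hp).2.1
  · exact fun p hp => by
      rw [(hx p hp).2.2.2.2.2]
      exact sign_eq_of_mul_pos (hsub p hp).2.2

/-- `Realizes` leaves the canonical signs `δ₁`, `δ₂` free; they are the values of `L` and `N` at
`p₀`, whose signs are prescribed. -/
theorem Realizes.isCanonical {R : Set (ℝ × ℝ)} {x : ℝ × ℝ → R31} {p₀ : ℝ × ℝ} {ε₁ ε₂ : ℝ}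
    {F H : ℝ × ℝ → ℝ} (h : Realizes R x p₀ ε₁ ε₂ F H) (hε₁ : ε₁ = 1 ∨ ε₁ = -1)
    (hε₂ : ε₂ = 1 ∨ ε₂ = -1) : IsCanonical R x p₀ ε₁ ε₂ := by
  obtain ⟨δ₁, δ₂, hδ⟩ := h.canonical
  have h1 := h.signL p₀ hδ.mem
  have h2 := h.signN p₀ hδ.mem
  have e1 : coeffL x p₀ = δ₁ := hδ.canonicalL p₀.1 hδ.mem
  have e2 : coeffN x p₀ = δ₂ := hδ.canonicalN p₀.2 hδ.mem
  rw [e1] at h1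
  rw [e2] at h2
  rwa [eq_of_sign_eq hδ.sign₁ hε₁ h1, eq_of_sign_eq hδ.sign₂ hε₂ h2] at hδ

end LorentzSurface

theorem mainTheorem1 (p₀ : ℝ × ℝ) (ε₁ ε₂ : ℝ)
    (hε₁ : ε₁ = 1 ∨ ε₁ = -1) (hε₂ : ε₂ = 1 ∨ ε₂ = -1) :
    (∀ (D : Set (ℝ × ℝ)) (x : ℝ × ℝ → R31), IsCanonical D x p₀ ε₁ ε₂ →
      IsNaturalSolution D p₀ ε₁ ε₂ (coeffF x) (meanH x) ∧
      ∀ g : R31 → R31, IsProperMotion g →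
        IsCanonical D (g ∘ x) p₀ ε₁ ε₂ ∧
        EqOn (coeffF (g ∘ x)) (coeffF x) D ∧ EqOn (meanH (g ∘ x)) (meanH x) D ∧
        IsNaturalSolution D p₀ ε₁ ε₂ (coeffF (g ∘ x)) (meanH (g ∘ x))) ∧
    (∀ (U : Set (ℝ × ℝ)) (F H : ℝ × ℝ → ℝ), IsOpen U → p₀ ∈ U →
      IsNaturalSolution U p₀ ε₁ ε₂ F H →
      (∃ R : Set (ℝ × ℝ), IsOpenRectangle R ∧ p₀ ∈ R ∧ R ⊆ U ∧
        ∃ x : ℝ × ℝ → R31, Realizes R x p₀ ε₁ ε₂ F H) ∧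
      (∀ R : Set (ℝ × ℝ), IsOpenRectangle R → p₀ ∈ R → R ⊆ U →
        ∀ x y : ℝ × ℝ → R31, Realizes R x p₀ ε₁ ε₂ F H → Realizes R y p₀ ε₁ ε₂ F H →
          ∃ g : R31 → R31, IsProperMotion g ∧ EqOn y (g ∘ x) R)) := by
  refine ⟨fun D x h => ⟨h.isNaturalSolution, fun g hg => ?_⟩, fun U F H hU hp₀ h =>
    ⟨h.exists_realizes hε₁ hε₂ hU hp₀, fun R hR _ _ x y hx hy => ?_⟩⟩
  · obtain ⟨h1, h2, h3⟩ := h.comp_properMotion hg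
    exact ⟨h1, h2, h3, h1.isNaturalSolution⟩
  · exact (hx.isCanonical hε₁ hε₂).exists_properMotion hR (hy.isCanonical hε₁ hε₂)
      (fun p hp => (hx.firstF hp).trans (hy.firstF hp).symm)
      fun p hp => (hx.mean hp).trans (hy.mean hp).symm
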